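/- **Definitions.** Graphs are loopless undirected graphs in which parallel edges are allowed. For a set $X$ and an element $a$ write $X+a=X\cup\{a\}$ and $X-a=X\setminus\{a\}$. For a graph $G=(V,E)$, a *tree pair* of $G$ is an ordered pair $(S,T)$ of disjoint spanning trees (as edge sets) with $S\cup T=E$; $G$ is *bispanning* if it has a tree pair, and *atomic* if it is bispanning and its only bispanning subgraphs are $G$ itself and the single vertices. For a spanning tree $T$, $C_G(T,e)$ ($e\notin T$) is the edge set of the unique cycle in $T+e$, and $D_G(T,e)$ ($e\in T$) is the set of edges of $G$ joining the two components of $(V,T-e)$. Given a tree pair $(S,T)$, let $D_G(\cdot,e)$ be the cut with respect to the tree of the pair containing $e$, and $C_G(\cdot,e)$ the cycle with respect to the other tree. A *unique exchange* of $G$ is a quadruple $(e,f,S,T)$ where $(S,T)$ is a tree pair and either $e\in S$ and $f$ is the only edge of $T$ such that $(S-e+f,\,T+e-f)$ is a tree pair, or $e\in T$ and $f$ is the only edge of $S$ such that $(S+e-f,\,T-e+f)$ is a tree pair; the tree pair so obtained is its *result*. The unique exchanges are the arcs of the directed unique exchange graph $\vec\tau_3(G)$. Let $G$ be an atomic bispanning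 graph and $v$ a vertex of degree three, with neighbours $x,y,z$ and incident edges $e_x,e_y,e_z$, where $e_u$ joins $v$ and $u$. Whenever $\{a,b,c\}=\{x,y,z\}$, let $G_{a,b}$ be the *reduction graph* obtained from $G$ by deleting $v$ and adding one new edge $e_{a,b}$ with ends $a,b$ (equivalently, contracting $e_a$, deleting $e_c$, and renaming $e_b$ to $e_{a,b}$). For a tree pair $(S,T)$ of $G_{a,b}$ put $$\rho_{e_{a,b},c}(S,T)=\begin{cases}(S-e_{a,b}+e_a+e_b,\;T+e_c)&\text{if } e_{a,b}\in S,\\ (S+e_c,\;T-e_{a,b}+e_a+e_b)&\text{if } e_{a,b}\in T.\end{cases}$$ For a tree pair $(S,T)$ of $G$, name the three edges so that $e_a,e_b$ lie in the same tree and the *attachment edge* $e_c$ in the other, and so that $e_a\in C_G(\cdot,e_c)$ (the *cycle edge*) and $e_b\notin C_G(\cdot,e_c)$ (the *non-cycle edge*). **Theorem.** Every unique exchange of $G$ belongs to exactly one of the following four classes, and conversely every member of these classes is a unique exchange of $G$. 1. (Lifted) $(e,f,\rho_{e_{a,b},c}(S,T))$, where $\{a,b,c\}=\{x,y,z\}$,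 $(e,f,S,T)$ is a unique exchange of $G_{a,b}$ with $e,f\ne e_{a,b}$, and it is not *broken*, that is, either $$e_{a,b}\in S\ \text{ and }\ e\notin D_{G_{a,b}}(S,e_{a,b})\cap C_G(T+e_c,e_a)\cap C_G(T+e_c,e_b),$$ or $$e_{a,b}\in T\ \text{ and }\ e\notin D_{G_{a,b}}(T,e_{a,b})\cap C_G(S+e_c,e_a)\cap C_G(S+e_c,e_b).$$ 2. (Leaf) $(e_c,e_a,S,T)$, where $(S,T)$ is a tree pair of $G$ with attachment edge $e_c$ and cycle edge $e_a$. 3. (Forwarded) for $\{a,b,c\}=\{x,y,z\}$ and a unique exchange $(g,e_{a,b},S,T)$ of $G_{a,b}$: the exchange $(g,e_2,\rho_{e_{a,b},c}(S,T))$ and its reverse $(e_2,g,S',T')$, where $e_2$ is the one of $e_a,e_b$ that lies in the cut $D_G(\cdot,g)$ for the tree pair $\rho_{e_{a,b},c}(S,T)$, and $(S',T')$ is the result of $(g,e_2,\rho_{e_{a,b},c}(S,T))$. 4. (Extra) $(e_a,e_c,S,T)$, where $(S,T)$ is a tree pair of $G$ with attachment edge $e_c$ and cycle edge $e_a$, and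 $D_G(\cdot,e_a)\cap C_G(\cdot,e_a)=\{e_a,e_c\}$. Moreover, every tree pair of $G$ has exactly one exchange in class 2, and for every unique exchange $(g,e_{a,b},S,T)$ of $G_{a,b}$ exactly one of $e_a,e_b$ qualifies as $e_2$ in class 3. -/

import Mathlib

open scoped Graph

namespace Graph

universe u w

variable {α : Type u} {β : Type w}

/-! ### Walks, cycles, trees -/

/-- `G.IsWalk s l t`: the list `l = [(e₁, v₁), …, (eₙ, vₙ)]` encodes an edge walk
`s = v₀, e₁, v₁, e₂, …, eₙ, vₙ = t` of `G`. -/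
inductive IsWalk (G : Graph α β) : α → List (β × α) → α → Prop
  | nil {s : α} (hs : s ∈ V(G)) : IsWalk G s [] s
  | cons {s m t : α} {e : β} {l : List (β × α)} (h : G.IsLink e s m) (hl : IsWalk G m l t) :
      IsWalk G s ((e, m) :: l) t

/-- The edge set of a cycle: a closed walk of positive length that repeats no edge, and no vertex
except that it ends where it starts. (A loop would be a cycle of length one, two parallel edges
form a cycle of length two.) -/
def IsCycle (G : Graph α β) (C : Set β) : Prop :=
  ∃ (s : α) (l : List (β × α)), l ≠ [] ∧ G.IsWalk s l s ∧
    (l.map Prod.fst).Nodup ∧ (l.map Prod.snd).Nodup ∧ C = {e | e ∈ l.map Prod.fst}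

/-- Two vertices joined by a walk. -/
def Joined (G : Graph α β) (s t : α) : Prop := ∃ l, G.IsWalk s l t

/-- A tree-graph: nonempty, connected, without cycles. -/
structure IsTreeGraph (G : Graph α β) : Prop where
  nonempty : V(G).Nonempty
  connected : ∀ s ∈ V(G), ∀ t ∈ V(G), G.Joined s t
  acyclic : ∀ C, ¬ G.IsCycle C

/-- `T` is (the edge set of) a spanning tree of `G`. -/
def IsSpanningTree (G : Graph α β) (T : Set β) : Prop :=
  T ⊆ E(G) ∧ (G.restrict T).IsTreeGraph

/-- `C_G(T, e)`: the edges of the cycle in `T + e`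
(for a spanning tree `T` and an edge `e ∉ T` there is exactly one). -/
def fundCycle (G : Graph α β) (T : Set β) (e : β) : Set β :=
  {f | ∃ C, (G.restrict (insert e T)).IsCycle C ∧ f ∈ C}

/-- `D_G(T, e)`: the edges of `G` whose ends lie in different components of `(V, T - e)`. -/
def fundCut (G : Graph α β) (T : Set β) (e : β) : Set β :=
  {f | ∃ s t, G.IsLink f s t ∧ ¬ (G.restrict (T \ {e})).Joined s t}

/-! ### Bispanning graphs and the directed unique exchange graph -/

/-- `(S, T)` is a vertex of the exchange graph: `E` is the disjoint union of the spanning trees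
`S` and `T`. -/
structure IsTreePair (G : Graph α β) (S T : Set β) : Prop where
  left : G.IsSpanningTree S
  right : G.IsSpanningTree T
  disjoint : Disjoint S T
  union : S ∪ T = E(G)

/-- A graph whose edge set is the disjoint union of two spanning trees. -/
def IsBispanning (G : Graph α β) : Prop := ∃ S T, G.IsTreePair S T

/-- A bispanning graph whose only bispanning subgraphs are itself and single vertices. -/
def IsAtomic (G : Graph α β) : Prop :=
  G.IsBispanning ∧ ∀ H : Graph α β, H ≤ G → H.IsBispanning → H = G ∨ ∃ u, V(H) = {u}

/-- The number of edges incident to `v`. -/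
noncomputable def deg (G : Graph α β) (v : α) : ℕ∞ := {e | G.Inc e v}.encard

/-- `(e, f) ∈ S × T` is a unique `S` edge exchange: `f` is the only edge of `T` such that
`(S - e + f, T + e - f)` is again a pair of disjoint spanning trees. -/
def IsUniqueExchange (G : Graph α β) (S T : Set β) (e f : β) : Prop :=
  e ∈ S ∧ f ∈ T ∧ G.IsTreePair (insert f (S \ {e})) (insert e T \ {f}) ∧
    ∀ f' ∈ T, G.IsTreePair (insert f' (S \ {e})) (insert e T \ {f'}) → f' = f

/-- `(e, f, S, T)` is an arc of the directed unique exchange graph of `G`: a unique `S` edge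
exchange or a unique `T` edge exchange for the tree pair `(S, T)`. -/
def IsTauArc (G : Graph α β) (e f : β) (S T : Set β) : Prop :=
  G.IsTreePair S T ∧ (G.IsUniqueExchange S T e f ∨ G.IsUniqueExchange T S e f)

open Classical in
/-- The head of the arc `(e, f, S, T)`: the tree pair after the exchange. -/
noncomputable def exchange (e f : β) (S T : Set β) : Set β × Set β :=
  if e ∈ S then (insert f (S \ {e}), insert e T \ {f})
  else (insert e S \ {f}, insert f (T \ {e}))

/-- `D_G(·, e)`: the fundamental cut of `e` with respect to the tree of `(S, T)` containing `e`. -/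
def pairCut (G : Graph α β) (S T : Set β) (e : β) : Set β :=
  {f | (e ∈ S ∧ f ∈ G.fundCut S e) ∨ (e ∈ T ∧ f ∈ G.fundCut T e)}

/-- `C_G(·, e)`: the fundamental cycle of `e` with respect to the tree of `(S, T)` not
containing `e`. -/
def pairCycle (G : Graph α β) (S T : Set β) (e : β) : Set β :=
  {f | (e ∈ S ∧ f ∈ G.fundCycle T e) ∨ (e ∈ T ∧ f ∈ G.fundCycle S e)}

/-! ### Reduction at a vertex of degree three -/

/-- The reduction graph `G_{a,b}` at the vertex `v`: `v` is deleted with its incident edges, and one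
new edge `e_{a,b}` with ends `a` and `b` is added. The edges `e` of `G - v` are labelled `some e`,
the split edge `e_{a,b}` is labelled `none`. For `v` of degree three with neighbours `a, b, c` this
is `G / {v,a} - {v,c}` with the edge `{v,b}` renamed. -/
def reduction (G : Graph α β) (v a b : α) : Graph α (Option β) where
  vertexSet := V(G) \ {v}
  IsLink e s t :=
    (∃ e' : β, e = some e' ∧ (G.deleteVerts {v}).IsLink e' s t) ∨
    (e = none ∧ a ∈ V(G) \ {v} ∧ b ∈ V(G) \ {v} ∧ ((s = a ∧ t = b) ∨ (s = b ∧ t = a)))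
  isLink_symm := by
    intro e _
    refine ⟨fun s t h => ?_⟩
    rcases h with ⟨e', he, h⟩ | ⟨he, ha, hb, h⟩
    · exact Or.inl ⟨e', he, h.symm⟩
    · exact Or.inr ⟨he, ha, hb, h.symm.imp And.symm And.symm⟩
  eq_or_eq_of_isLink_of_isLink := by
    rintro e s t p q (⟨e', rfl, h⟩ | ⟨rfl, -, -, h⟩) (⟨e'', he, h'⟩ | ⟨he, -, -, h'⟩)
    · obtain rfl := Option.some.inj he
      exact h.left_eq_or_eq h'
    · simp at he
    · simp at he
    · grind
  left_mem_of_isLink := by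
    rintro e s t (⟨e', rfl, h⟩ | ⟨rfl, ha, hb, ⟨rfl, rfl⟩ | ⟨rfl, rfl⟩⟩)
    · simpa using h.left_mem
    · exact ha
    · exact hb

open Classical in
/-- The edge-split-attach operation `ρ` on tree pairs of a reduction graph: the split edge is
replaced by `ea` and `eb` in its tree, and `ec` is added to the other tree. -/
noncomputable def rho (ea eb ec : β) (S T : Set (Option β)) : Set β × Set β :=
  if none ∈ S then (some ⁻¹' S ∪ {ea, eb}, some ⁻¹' T ∪ {ec})
  else (some ⁻¹' S ∪ {ec}, some ⁻¹' T ∪ {ea, eb})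

/-- The condition under which an exchange from `e` for the tree pair `(S, T)` of the reduction
graph `H = G_{a,b}` is not broken by `ρ`. -/
def NotBroken (G : Graph α β) (H : Graph α (Option β)) (ea eb ec e : β)
    (S T : Set (Option β)) : Prop :=
  (none ∈ S ∧ ¬ (some e ∈ H.fundCut S none ∧
    e ∈ G.fundCycle (some ⁻¹' T ∪ {ec}) ea ∧ e ∈ G.fundCycle (some ⁻¹' T ∪ {ec}) eb)) ∨
  (none ∈ T ∧ ¬ (some e ∈ H.fundCut T none ∧
    e ∈ G.fundCycle (some ⁻¹' S ∪ {ec}) ea ∧ e ∈ G.fundCycle (some ⁻¹' S ∪ {ec}) eb))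

/-- For the tree pair `(S, T)`, `ec` is the attachment edge (the only one of the three of its
colour), `ea` the cycle edge and `eb` the non-cycle edge. -/
def HasRoles (G : Graph α β) (ea eb ec : β) (S T : Set β) : Prop :=
  G.IsTreePair S T ∧ ((ea ∈ S ∧ eb ∈ S ∧ ec ∈ T) ∨ (ea ∈ T ∧ eb ∈ T ∧ ec ∈ S)) ∧
    ea ∈ G.pairCycle S T ec ∧ eb ∉ G.pairCycle S T ec

/-- Pairwise distinct indices: `i`, `j`, `k` assign the names `a`, `b`, `c` to the three
neighbours. -/
def Distinct (i j k : Fin 3) : Prop := i ≠ j ∧ i ≠ k ∧ j ≠ k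

/-- `e₂` is the edge to which an exchange `(g, e_{a,b}, S, T)` of `G_{a,b}` is forwarded: the one of
`ea`, `eb` lying in the cut `D_G(·, g)` of the lifted tree pair `ρ(S, T)`. -/
def IsForwardEdge (G : Graph α β) (ea eb ec g : β) (S T : Set (Option β)) (e₂ : β) : Prop :=
  (e₂ = ea ∨ e₂ = eb) ∧ e₂ ∈ G.pairCut (rho ea eb ec S T).1 (rho ea eb ec S T).2 g

/-- The names of the four classes. -/
inductive ExchangeClass
  | lifted
  | leaf
  | forwarded
  | extra

/-- Membership of `(e, f, S, T)` in each of the four classes, where `v` is a vertex of degree three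
with neighbours `x 0, x 1, x 2` and incident edges `d 0, d 1, d 2`. -/
def InClass (G : Graph α β) (v : α) (x : Fin 3 → α) (d : Fin 3 → β) (e f : β) (S T : Set β) :
    ExchangeClass → Prop
  | .lifted => ∃ i j k, Distinct i j k ∧ ∃ S₀ T₀ : Set (Option β),
      (G.reduction v (x i) (x j)).IsTauArc (some e) (some f) S₀ T₀ ∧
      G.NotBroken (G.reduction v (x i) (x j)) (d i) (d j) (d k) e S₀ T₀ ∧
      (S, T) = rho (d i) (d j) (d k) S₀ T₀
  | .leaf => ∃ i j k, Distinct i j k ∧ G.HasRoles (d i) (d j) (d k) S T ∧ e = d k ∧ f = d i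
  | .forwarded => ∃ i j k, Distinct i j k ∧ ∃ (S₀ T₀ : Set (Option β)) (g e₂ : β),
      (G.reduction v (x i) (x j)).IsTauArc (some g) none S₀ T₀ ∧
      G.IsForwardEdge (d i) (d j) (d k) g S₀ T₀ e₂ ∧
      ((e = g ∧ f = e₂ ∧ (S, T) = rho (d i) (d j) (d k) S₀ T₀) ∨
       (e = e₂ ∧ f = g ∧ (S, T) = exchange g e₂ (rho (d i) (d j) (d k) S₀ T₀).1
          (rho (d i) (d j) (d k) S₀ T₀).2))
  | .extra => ∃ i j k, Distinct i j k ∧ G.HasRoles (d i) (d j) (d k) S T ∧ e = d i ∧ f = d k ∧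
      G.pairCut S T (d i) ∩ G.pairCycle S T (d i) = {d i, d k}

end Graph

/-! Everything is phrased through one relation, `Conn G A`. A spanning tree is a connecting edge set
all of whose edges are bridges (`isSpanningTree_iff`), and membership in a fundamental cut or cycle
says whether the ends of an edge stay connected after a deletion. Exchanging `e ∈ S` for `f ∈ T`
works iff `f ∈ D(S, e)` and `e ∈ D(T, f)` (`IsTreePair.exchange_iff`), so unique exchanges are a
matter of cuts alone.

No spanning tree leaves `v` isolated, so the three edges at `v` are divided two to one. Up to
interchanging the trees, a tree pair of `G` is `(A + ea + eb, B + ec)` with `A`, `B` avoiding `v`,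
and it corresponds to the pair `(A + none, B)` of `G_{a,b}`: an edge is subdivided in one tree, a
pendant edge is added to the other (`IsClaw.isTreePair_iff`). Away from `v` the cuts agree, the cuts
of `ea` and `eb` both becoming the cut of `none`; the cut of `ec` is the star of `v`.

Unique exchanges are now sorted by which of `e`, `f` meet `v`. If neither does and `e ∈ A`, the
candidates for `f` are the same in both graphs. If `e ∈ B`, then `ea`, `eb`, `none` cross the cut of
`e` when `B - e` separates `c` from `a`, `c` from `b`, `a` from `b`, respectively. Since `B - e` has
two components on `G - v`, zero or two of these pairs are separated. When `e` lies in the cut of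
`none`, this leaves two possibilities. Either `none` is a candidate and exactly one of `ea`, `eb`
takes its place (forwarding), or it is not and `ea`, `eb` are both candidates or both not; "both" is
the broken case. The decisive lemmas are `exchange_attach_iff`, `exchange_of_forward` and
`forward_of_exchange`.

If only `f` meets `v`, the exchange is forwarded; if only `e` does, it is the reverse of a forwarded
one from another reduction (`forwarded_of_right`). If both do, one of them is the attachment edge
and the other must be the cycle edge, which gives leaf or extra according to the direction.
Incidence with `v` and this direction also separate the classes. -/

open scoped Graph

namespace Graph

universe u w

variable {α : Type u} {β : Type w} {G : Graph α β} {A B S T : Set β} {e f g h ea eb ec : β}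
  {v a b c s t p q : α} {x : Fin 3 → α} {d : Fin 3 → β} {i j k i' j' k' : Fin 3}

/-! ### Connectedness by a set of edges -/

/-- `G.Conn A s t`: the vertices `s` and `t` are connected by edges from `A`. -/
def Conn (G : Graph α β) (A : Set β) : α → α → Prop :=
  Relation.ReflTransGen fun s t => ∃ e ∈ A, G.IsLink e s t

lemma Conn.refl (G : Graph α β) (A : Set β) (s : α) : G.Conn A s s := Relation.ReflTransGen.refl

lemma Conn.trans (h : G.Conn A s t) (h' : G.Conn A t p) : G.Conn A s p :=
  Relation.ReflTransGen.trans h h'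

lemma Conn.symm (h : G.Conn A s t) : G.Conn A t s :=
  have : Std.Symm fun s t => ∃ e ∈ A, G.IsLink e s t :=
    ⟨fun _ _ ⟨e, he, hl⟩ => ⟨e, he, hl.symm⟩⟩
  Relation.ReflTransGen.stdSymm.symm _ _ h

lemma conn_comm : G.Conn A s t ↔ G.Conn A t s := ⟨Conn.symm, Conn.symm⟩

lemma IsLink.conn (h : G.IsLink e s t) (he : e ∈ A) : G.Conn A s t :=
  Relation.ReflTransGen.single ⟨e, he, h⟩

lemma Conn.mono (h : G.Conn A s t) (hAB : A ⊆ B) : G.Conn B s t :=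
  Relation.ReflTransGen.mono (fun _ _ ⟨e, he, hl⟩ => ⟨e, hAB he, hl⟩) _ _ h

/-- The new edge need be crossed at most once, in one of its two directions. All later computations
with an added edge rest on this. -/
lemma conn_insert_iff (h : G.IsLink e s t) : G.Conn (insert e A) p q ↔
    G.Conn A p q ∨ (G.Conn A p s ∧ G.Conn A t q) ∨ (G.Conn A p t ∧ G.Conn A s q) := by
  constructor
  · intro hpq
    induction hpq with
    | refl => exact Or.inl (Conn.refl G A _)
    | @tail b c _ hbc ih =>
      obtain ⟨f, rfl | hf, hl⟩ := hbc
      · rcases hl.eq_and_eq_or_eq_and_eq h with ⟨rfl, rfl⟩ | ⟨rfl, rfl⟩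
        · rcases ih with ih | ⟨ih, ih'⟩ | ⟨ih, ih'⟩
          · exact Or.inr (Or.inl ⟨ih, Conn.refl G A _⟩)
          · exact Or.inr (Or.inl ⟨ih, Conn.refl G A _⟩)
          · exact Or.inl ih
        · rcases ih with ih | ⟨ih, ih'⟩ | ⟨ih, ih'⟩
          · exact Or.inr (Or.inr ⟨ih, Conn.refl G A _⟩)
          · exact Or.inl ih
          · exact Or.inr (Or.inr ⟨ih, Conn.refl G A _⟩)
      · have := hl.conn hf
        exact ih.imp (·.trans this) (Or.imp (And.imp_right (·.trans this))
          (And.imp_right (·.trans this)))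
  · have hi : A ⊆ insert e A := Set.subset_insert _ _
    have hst := h.conn (Set.mem_insert e A)
    rintro (h1 | ⟨h1, h2⟩ | ⟨h1, h2⟩)
    · exact h1.mono hi
    · exact (h1.mono hi).trans (hst.trans (h2.mono hi))
    · exact (h1.mono hi).trans (hst.symm.trans (h2.mono hi))

/-! ### Walks and cycles -/

lemma IsWalk.conn {l : List (β × α)} (h : (G.restrict A).IsWalk s l t) : G.Conn A s t := by
  induction h with
  | nil => exact Conn.refl G A _
  | cons hl _ ih => exact (hl.2.conn hl.1).trans ih

lemma IsWalk.conn_sdiff {l : List (β × α)} (h : (G.restrict A).IsWalk s l t)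
    (hf : f ∉ l.map Prod.fst) : G.Conn (A \ {f}) s t := by
  induction h with
  | nil => exact Conn.refl G _ _
  | @cons s m t e l hl _ ih =>
    simp only [List.map_cons, List.mem_cons, not_or] at hf
    exact (hl.2.conn (A := A \ {f}) ⟨hl.1, fun h => hf.1 h.symm⟩).trans (ih hf.2)

/-- The walk is cut at `f`; as no edge repeats, both pieces avoid `f`. -/
lemma IsWalk.exists_isLink_of_mem {l : List (β × α)} (h : (G.restrict A).IsWalk s l t)
    (hl : (l.map Prod.fst).Nodup) (hf : f ∈ l.map Prod.fst) :
    f ∈ A ∧ ∃ p q, G.IsLink f p q ∧ G.Conn (A \ {f}) s p ∧ G.Conn (A \ {f}) q t := by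
  induction h with
  | nil => simp at hf
  | @cons s m t e l hlink hw ih =>
    rw [List.map_cons, List.nodup_cons] at hl
    by_cases hef : f = e
    · subst hef
      exact ⟨hlink.1, s, m, hlink.2, Conn.refl G _ _, hw.conn_sdiff hl.1⟩
    · rw [List.map_cons, List.mem_cons] at hf
      obtain ⟨hfA, p, q, hpq, h1, h2⟩ := ih hl.2 (hf.resolve_left hef)
      exact ⟨hfA, p, q, hpq,
        (hlink.2.conn (A := A \ {f}) ⟨hlink.1, fun h => hef h.symm⟩).trans h1, h2⟩

/-- A walk without repeated vertices and edges. -/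
def IsPathWalk (G : Graph α β) (s : α) (l : List (β × α)) (t : α) : Prop :=
  G.IsWalk s l t ∧ (s :: l.map Prod.snd).Nodup ∧ (l.map Prod.fst).Nodup

lemma IsWalk.mem_of_isLink_mem {l : List (β × α)} (h : G.IsWalk s l t)
    (hf : f ∈ l.map Prod.fst) (hpq : G.IsLink f p q) : p ∈ s :: l.map Prod.snd := by
  induction h with
  | nil => simp at hf
  | @cons s m t e l hlink hw ih =>
    rw [List.map_cons, List.mem_cons] at hf
    rcases hf with rfl | hf
    · rcases hpq.left_eq_or_eq hlink with rfl | rfl <;> simp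
    · exact List.mem_cons_of_mem _ (ih hf)

lemma IsPathWalk.exists_of_mem {l : List (β × α)} (h : G.IsPathWalk s l t)
    (hp : p ∈ s :: l.map Prod.snd) : ∃ l', G.IsPathWalk p l' t := by
  obtain ⟨hw, hv, he⟩ := h
  induction hw with
  | @nil s hs =>
    obtain rfl : p = s := by simpa using hp
    exact ⟨[], .nil hs, by simp, by simp⟩
  | @cons s m t e l hlink hw ih =>
    rcases List.mem_cons.1 hp with rfl | hp
    · exact ⟨_, .cons hlink hw, hv, he⟩
    · exact ih hp (List.nodup_cons.1 hv).2 (List.nodup_cons.1 he).2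

lemma Conn.exists_isPathWalk (h : G.Conn A s t) (ht : t ∈ V(G)) :
    ∃ l, (G.restrict A).IsPathWalk s l t := by
  induction h using Relation.ReflTransGen.head_induction_on with
  | refl => exact ⟨[], .nil ht, by simp, by simp⟩
  | @head s m hsm _ ih =>
    obtain ⟨e, heA, hl⟩ := hsm
    obtain ⟨l, hlw⟩ := ih
    -- If the new start already lies on the path, the prefix before it is discarded.
    by_cases hs : s ∈ m :: l.map Prod.snd
    · exact hlw.exists_of_mem hs
    · have hl' : (G.restrict A).IsLink e s m := ⟨heA, hl⟩
      refine ⟨(e, m) :: l, .cons hl' hlw.1, ?_, ?_⟩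
      · exact List.nodup_cons.2 ⟨hs, hlw.2.1⟩
      · exact List.nodup_cons.2 ⟨fun he => hs (hlw.1.mem_of_isLink_mem he hl'), hlw.2.2⟩

/-- `Conn` is reflexive on all of `α`, while the empty walk needs a vertex of `G`; hence the
hypothesis on `t`. -/
lemma joined_restrict_iff (ht : t ∈ V(G)) : (G.restrict A).Joined s t ↔ G.Conn A s t :=
  ⟨fun ⟨_, h⟩ => h.conn, fun h => let ⟨l, hl⟩ := h.exists_isPathWalk ht; ⟨l, hl.1⟩⟩

/-- An edge lies on a cycle if and only if its ends are connected by the other edges. -/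
lemma exists_isCycle_iff : (∃ C, (G.restrict A).IsCycle C ∧ f ∈ C) ↔
    f ∈ A ∧ ∃ s t, G.IsLink f s t ∧ G.Conn (A \ {f}) s t := by
  constructor
  · rintro ⟨C, ⟨s, l, -, hw, he, -, rfl⟩, hf⟩
    obtain ⟨hfA, p, q, hpq, h1, h2⟩ := hw.exists_isLink_of_mem he hf
    exact ⟨hfA, p, q, hpq, (h2.trans h1).symm⟩
  · rintro ⟨hfA, s, t, hst, hc⟩
    obtain ⟨l, hw, hv, he⟩ := hc.symm.exists_isPathWalk hst.left_mem
    have hw' : (G.restrict A).IsWalk t l s := by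
      clear hv he hst hc
      induction hw with
      | nil hs => exact .nil hs
      | cons hl _ ih => exact .cons ⟨hl.1.1, hl.2⟩ ih
    have hf : f ∉ l.map Prod.fst := by
      clear hv he hst hc hw'
      induction hw with
      | nil => simp
      | cons hl _ ih =>
        rw [List.map_cons, List.mem_cons, not_or]
        exact ⟨fun h => hl.1.2 h.symm, ih⟩
    refine ⟨_, ⟨s, (f, t) :: l, by simp, .cons ⟨hfA, hst⟩ hw', ?_, hv, rfl⟩, by simp⟩
    exact List.nodup_cons.2 ⟨hf, he⟩

/-! ### Spanning trees, fundamental cycles and cuts through connectedness -/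

lemma IsLink.conn_iff (h : G.IsLink e s t) (h' : G.IsLink e p q) :
    G.Conn A s t ↔ G.Conn A p q := by
  rcases h.eq_and_eq_or_eq_and_eq h' with ⟨rfl, rfl⟩ | ⟨rfl, rfl⟩
  · rfl
  · exact conn_comm

/-- Every cycle has an edge, and an edge lies on a cycle exactly when it is not a bridge, so
acyclicity can be tested edge by edge. -/
lemma isSpanningTree_iff : G.IsSpanningTree T ↔ T ⊆ E(G) ∧ V(G).Nonempty ∧
    (∀ s ∈ V(G), ∀ t ∈ V(G), G.Conn T s t) ∧
    ∀ f ∈ T, ∀ s t, G.IsLink f s t → ¬ G.Conn (T \ {f}) s t := by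
  refine and_congr_right fun _ => ⟨fun h => ⟨h.nonempty, fun s hs t ht => ?_, ?_⟩,
    fun h => ⟨h.1, fun s hs t ht => ?_, ?_⟩⟩
  · exact (joined_restrict_iff ht).1 (h.connected s hs t ht)
  · intro f hf s t hst hc
    obtain ⟨C, hC, -⟩ := exists_isCycle_iff.2 ⟨hf, s, t, hst, hc⟩
    exact h.acyclic C hC
  · exact (joined_restrict_iff (G := G) ht).2 (h.2.1 s hs t ht)
  · intro C hC
    have : ∃ f, f ∈ C := by
      obtain ⟨s, l, hl, -, -, -, rfl⟩ := hC
      obtain ⟨a, ha⟩ := List.exists_mem_of_ne_nil l hl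
      exact ⟨a.1, List.mem_map_of_mem ha⟩
    obtain ⟨f, hf⟩ := this
    obtain ⟨hfT, s, t, hst, hc⟩ := exists_isCycle_iff.1 ⟨C, hC, hf⟩
    exact h.2.2 f hfT s t hst hc

lemma IsLink.mem_fundCut_iff (h : G.IsLink f s t) :
    f ∈ G.fundCut T e ↔ ¬ G.Conn (T \ {e}) s t := by
  constructor
  · rintro ⟨p, q, hpq, hc⟩
    rwa [joined_restrict_iff hpq.right_mem, hpq.conn_iff h] at hc
  · exact fun hc => ⟨s, t, h, by rwa [joined_restrict_iff h.right_mem]⟩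

lemma IsLink.mem_fundCycle_iff (h : G.IsLink f s t) :
    f ∈ G.fundCycle T e ↔ f ∈ insert e T ∧ G.Conn (insert e T \ {f}) s t := by
  refine exists_isCycle_iff.trans (and_congr_right fun _ => ⟨?_, fun hc => ⟨s, t, h, hc⟩⟩)
  rintro ⟨p, q, hpq, hc⟩
  rwa [hpq.conn_iff h] at hc

lemma edge_mem_of_mem_fundCut (h : f ∈ G.fundCut T e) : f ∈ E(G) :=
  let ⟨_, _, hl, _⟩ := h; hl.edge_mem

namespace IsSpanningTree

lemma subset (hT : G.IsSpanningTree T) : T ⊆ E(G) := hT.1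

lemma conn (hT : G.IsSpanningTree T) (hs : s ∈ V(G)) (ht : t ∈ V(G)) : G.Conn T s t :=
  (isSpanningTree_iff.1 hT).2.2.1 s hs t ht

lemma not_conn (hT : G.IsSpanningTree T) (he : e ∈ T) (h : G.IsLink e s t) :
    ¬ G.Conn (T \ {e}) s t :=
  (isSpanningTree_iff.1 hT).2.2.2 e he s t h

/-- Removing an edge from a spanning tree leaves the two components of its ends. -/
lemma conn_or (hT : G.IsSpanningTree T) (he : e ∈ T) (h : G.IsLink e s t) (hp : p ∈ V(G)) :
    G.Conn (T \ {e}) p s ∨ G.Conn (T \ {e}) p t := by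
  have hc := hT.conn hp h.left_mem
  rw [← Set.insert_sdiff_self_of_mem he, conn_insert_iff h] at hc
  rcases hc with hc | hc | hc
  · exact Or.inl hc
  · exact Or.inl hc.1
  · exact Or.inr hc.1

/-- `T - e` has only two components, so two vertices both separated from `q` are together. This is
the parity fact behind forwarding. -/
lemma conn_of_not_conn (hT : G.IsSpanningTree T) (he : e ∈ T) {r : α} (hp : p ∈ V(G))
    (hq : q ∈ V(G)) (hr : r ∈ V(G)) (hpq : ¬ G.Conn (T \ {e}) p q)
    (hqr : ¬ G.Conn (T \ {e}) q r) : G.Conn (T \ {e}) p r := by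
  obtain ⟨s, t, h⟩ := exists_isLink_of_mem_edgeSet (hT.subset he)
  rcases hT.conn_or he h hp with h1 | h1 <;> rcases hT.conn_or he h hq with h2 | h2 <;>
    rcases hT.conn_or he h hr with h3 | h3
  all_goals first
    | exact h1.trans h3.symm
    | exact absurd (h1.trans h2.symm) hpq
    | exact absurd (h2.trans h3.symm) hqr

lemma not_mem_fundCut (hT : G.IsSpanningTree T) (hf : f ∈ T) (hne : f ≠ e) :
    f ∉ G.fundCut T e := by
  obtain ⟨s, t, h⟩ := exists_isLink_of_mem_edgeSet (hT.subset hf)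
  rw [h.mem_fundCut_iff, not_not]
  exact h.conn ⟨hf, hne⟩

lemma insert_sdiff_iff (hT : G.IsSpanningTree T) (he : e ∈ T) (hfT : f ∉ T) (hf : f ∈ E(G)) :
    G.IsSpanningTree (insert f (T \ {e})) ↔ f ∈ G.fundCut T e := by
  obtain ⟨s, t, h⟩ := exists_isLink_of_mem_edgeSet hf
  rw [h.mem_fundCut_iff]
  have hfe : f ∉ T \ {e} := fun h => hfT h.1
  constructor
  · intro hT'
    have := hT'.not_conn (Set.mem_insert _ _) h
    rwa [Set.insert_sdiff_self_of_notMem hfe] at this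
  · intro hst
    rw [isSpanningTree_iff] at hT ⊢
    refine ⟨Set.insert_subset hf (Set.sdiff_subset.trans hT.1), hT.2.1, fun p hp q hq => ?_, ?_⟩
    · rw [← isSpanningTree_iff] at hT
      rw [conn_insert_iff h]
      have key : ∀ r ∈ V(G), G.Conn (T \ {e}) r s ∨ G.Conn (T \ {e}) r t := by
        intro r hr
        by_contra! hcon
        exact hst (hT.conn_of_not_conn he h.left_mem hr h.right_mem
          (fun h' => hcon.1 h'.symm) hcon.2)
      rcases key p hp with h1 | h1 <;> rcases key q hq with h2 | h2
      · exact Or.inl (h1.trans h2.symm)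
      · exact Or.inr (Or.inl ⟨h1, h2.symm⟩)
      · exact Or.inr (Or.inr ⟨h1, h2.symm⟩)
      · exact Or.inl (h1.trans h2.symm)
    · rintro g (rfl | hg) p q hpq hc
      · rw [Set.insert_sdiff_self_of_notMem hfe] at hc
        exact hst ((h.conn_iff hpq).2 hc)
      · have hgf : g ≠ f := fun h => hfe (h ▸ hg)
        -- A connection of the ends of `g` without `g` either avoids `f`, so that `g` is no bridge
        -- of `T`, or closes up through `g` to connect the ends of `f` in `T - e`.
        rw [Set.insert_sdiff_of_notMem _ (by simpa using hgf.symm), conn_insert_iff h] at hc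
        have hsub : (T \ {e}) \ {g} ⊆ T \ {e} := Set.sdiff_subset
        have hg' := hpq.conn hg
        rcases hc with hc | ⟨h1, h2⟩ | ⟨h1, h2⟩
        · exact hT.2.2.2 g hg.1 p q hpq (hc.mono (Set.sdiff_subset_sdiff_left Set.sdiff_subset))
        · exact hst ((h1.mono hsub).symm.trans (hg'.trans (h2.mono hsub).symm))
        · exact hst ((h2.mono hsub).trans (hg'.symm.trans (h1.mono hsub)))

/-- Duality of fundamental cycles and fundamental cuts. -/
lemma mem_fundCycle_iff (hT : G.IsSpanningTree T) (he : e ∈ T) (hfT : f ∉ T) (hf : f ∈ E(G)) :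
    e ∈ G.fundCycle T f ↔ f ∈ G.fundCut T e := by
  obtain ⟨s, t, h⟩ := exists_isLink_of_mem_edgeSet hf
  obtain ⟨p, q, h'⟩ := exists_isLink_of_mem_edgeSet (hT.subset he)
  have hne : f ≠ e := fun h => hfT (h ▸ he)
  rw [h.mem_fundCut_iff, h'.mem_fundCycle_iff,
    Set.insert_sdiff_of_notMem _ (by simpa using hne), conn_insert_iff h]
  have hpq := hT.not_conn he h'
  constructor
  · rintro ⟨-, hc | ⟨h1, h2⟩ | ⟨h1, h2⟩⟩ hst
    · exact hpq hc
    · exact hpq (h1.trans (hst.trans h2))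
    · exact hpq (h1.trans (hst.symm.trans h2))
  · intro hst
    refine ⟨Set.mem_insert_of_mem _ he, Or.inr ?_⟩
    rcases hT.conn_or he h' h.left_mem with h1 | h1 <;>
      rcases hT.conn_or he h' h.right_mem with h2 | h2
    · exact absurd (h1.trans h2.symm) hst
    · exact Or.inl ⟨h1.symm, h2⟩
    · exact Or.inr ⟨h2.symm, h1⟩
    · exact absurd (h1.trans h2.symm) hst

lemma self_mem_fundCut (hT : G.IsSpanningTree T) (he : e ∈ T) : e ∈ G.fundCut T e := by
  obtain ⟨s, t, h⟩ := exists_isLink_of_mem_edgeSet (hT.subset he)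
  exact h.mem_fundCut_iff.2 (hT.not_conn he h)

lemma self_mem_fundCycle (hT : G.IsSpanningTree T) (hfT : f ∉ T) (hf : f ∈ E(G)) :
    f ∈ G.fundCycle T f := by
  obtain ⟨s, t, h⟩ := exists_isLink_of_mem_edgeSet hf
  rw [h.mem_fundCycle_iff, Set.insert_sdiff_self_of_notMem hfT]
  exact ⟨Set.mem_insert _ _, hT.conn h.left_mem h.right_mem⟩

end IsSpanningTree

lemma mem_insert_of_mem_fundCycle (h : f ∈ G.fundCycle T e) : f ∈ insert e T :=
  (exists_isCycle_iff.1 h).1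

/-! ### Tree pairs and unique exchanges -/

namespace IsTreePair

lemma symm (h : G.IsTreePair S T) : G.IsTreePair T S :=
  ⟨h.right, h.left, h.disjoint.symm, by rw [Set.union_comm]; exact h.union⟩

lemma notMem_right (h : G.IsTreePair S T) (he : e ∈ S) : e ∉ T :=
  Set.disjoint_left.1 h.disjoint he

lemma notMem_left (h : G.IsTreePair S T) (he : e ∈ T) : e ∉ S :=
  Set.disjoint_right.1 h.disjoint he

lemma ne (h : G.IsTreePair S T) (he : e ∈ S) (hf : f ∈ T) : e ≠ f :=
  fun hef => h.notMem_right he (hef ▸ hf)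

lemma mem_or_mem (h : G.IsTreePair S T) (he : e ∈ E(G)) : e ∈ S ∨ e ∈ T := by
  rwa [← h.union] at he

/-- Disjointness and the union survive any swap, so only the two spanning tree conditions matter,
and each is a cut condition. -/
lemma exchange_iff (h : G.IsTreePair S T) (he : e ∈ S) (hf : f ∈ T) :
    G.IsTreePair (insert f (S \ {e})) (insert e T \ {f}) ↔
      f ∈ G.fundCut S e ∧ e ∈ G.fundCut T f := by
  rw [Set.insert_sdiff_of_notMem _ (by simpa using h.ne he hf),
    ← h.left.insert_sdiff_iff he (h.notMem_left hf) (h.right.subset hf),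
    ← h.right.insert_sdiff_iff hf (h.notMem_right he) (h.left.subset he)]
  refine ⟨fun h' => ⟨h'.left, h'.right⟩, fun h' => ⟨h'.1, h'.2, ?_, ?_⟩⟩
  · have := h.disjoint
    rw [Set.disjoint_left] at this ⊢
    rintro g (rfl | ⟨hg, hge⟩) (rfl | ⟨hg', hgf⟩)
    · exact h.notMem_left hf he
    · exact hgf rfl
    · exact hge rfl
    · exact this hg hg'
  · rw [← h.union]
    ext g
    simp only [Set.mem_union, Set.mem_insert_iff, Set.mem_sdiff, Set.mem_singleton_iff]
    by_cases h1 : g = e <;> by_cases h2 : g = f <;> simp_all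

lemma isUniqueExchange_iff (h : G.IsTreePair S T) : G.IsUniqueExchange S T e f ↔
    e ∈ S ∧ f ∈ T ∧ ∀ f' ∈ T, (f' ∈ G.fundCut S e ∧ e ∈ G.fundCut T f') ↔ f' = f := by
  refine and_congr_right fun he => and_congr_right fun hf => ?_
  constructor
  · rintro ⟨h1, h2⟩ f' hf'
    rw [← h.exchange_iff he hf']
    exact ⟨h2 f' hf', by rintro rfl; exact h1⟩
  · intro h1
    exact ⟨(h.exchange_iff he hf).2 ((h1 f hf).2 rfl),
      fun f' hf' h2 => (h1 f' hf').1 ((h.exchange_iff he hf').1 h2)⟩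

end IsTreePair

/-- Removing `f` again leaves the same `S - e` and `T + e`, so a candidate other than `e` would have
been a second candidate for the original exchange. -/
lemma IsUniqueExchange.reverse (h : G.IsTreePair S T) (hu : G.IsUniqueExchange S T e f) :
    G.IsUniqueExchange (insert f (S \ {e})) (insert e T \ {f}) f e := by
  obtain ⟨he, hf, hp, huniq⟩ := hu
  have hne := h.ne he hf
  have hfS : f ∉ S \ {e} := fun hh => h.notMem_left hf hh.1
  have h1 : insert f (S \ {e}) \ {f} = S \ {e} := Set.insert_sdiff_self_of_notMem hfS
  have h2 : insert f (insert e T \ {f}) = insert e T :=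
    Set.insert_sdiff_self_of_mem (Set.mem_insert_of_mem _ hf)
  refine ⟨Set.mem_insert _ _, ⟨Set.mem_insert _ _, hne⟩, ?_, ?_⟩
  · rw [h1, h2, Set.insert_sdiff_self_of_mem he,
      Set.insert_sdiff_self_of_notMem (h.notMem_right he)]
    exact h
  · rintro f' ⟨rfl | hf', hff'⟩ hp'
    · rfl
    · rw [h1, h2] at hp'
      exact absurd (huniq f' hf' hp') hff'

lemma IsTauArc.symm (h : G.IsTauArc e f S T) : G.IsTauArc e f T S := ⟨h.1.symm, h.2.symm⟩

/-! ### Connectedness in the reduction graph -/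

/-- No edge of `A` is incident to `v`. -/
def Avoids (G : Graph α β) (v : α) (A : Set β) : Prop := ∀ e ∈ A, ¬ G.Inc e v

/-- The edges at `v` are `ea`, `eb`, `ec`, with other ends `a`, `b`, `c` different from `v`. -/
structure IsClaw (G : Graph α β) (v a b c : α) (ea eb ec : β) : Prop where
  link_a : G.IsLink ea v a
  link_b : G.IsLink eb v b
  link_c : G.IsLink ec v c
  ne_a : a ≠ v
  ne_b : b ≠ v
  ne_c : c ≠ v
  ab : ea ≠ eb
  ac : ea ≠ ec
  bc : eb ≠ ec
  eq_of_inc : ∀ e, G.Inc e v → e = ea ∨ e = eb ∨ e = ec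

namespace IsClaw

lemma swap (hc : G.IsClaw v a b c ea eb ec) : G.IsClaw v b a c eb ea ec where
  link_a := hc.link_b
  link_b := hc.link_a
  link_c := hc.link_c
  ne_a := hc.ne_b
  ne_b := hc.ne_a
  ne_c := hc.ne_c
  ab := hc.ab.symm
  ac := hc.bc
  bc := hc.ac
  eq_of_inc := fun e he => by have := hc.eq_of_inc e he; tauto

lemma rotate (hc : G.IsClaw v a b c ea eb ec) : G.IsClaw v b c a eb ec ea where
  link_a := hc.link_b
  link_b := hc.link_c
  link_c := hc.link_a
  ne_a := hc.ne_b
  ne_b := hc.ne_c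
  ne_c := hc.ne_a
  ab := hc.bc
  ac := hc.ab.symm
  bc := hc.ac.symm
  eq_of_inc := fun e he => by have := hc.eq_of_inc e he; tauto

end IsClaw

lemma Avoids.notMem (hA : G.Avoids v A) (h : G.IsLink e v s) : e ∉ A :=
  fun he => hA e he h.inc_left

lemma Avoids.sdiff (hA : G.Avoids v A) (B : Set β) : G.Avoids v (A \ B) :=
  fun e he => hA e he.1

lemma IsLink.ne_left (h : G.IsLink e s t) (he : ¬ G.Inc e v) : s ≠ v := by
  rintro rfl; exact he h.inc_left

lemma IsLink.ne_right (h : G.IsLink e s t) (he : ¬ G.Inc e v) : t ≠ v := by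
  rintro rfl; exact he h.inc_right

lemma reduction_isLink_some :
    (G.reduction v a b).IsLink (some e) s t ↔ G.IsLink e s t ∧ s ≠ v ∧ t ≠ v := by
  simp [reduction]

lemma IsLink.reduction (h : G.IsLink e s t) (he : ¬ G.Inc e v) :
    (G.reduction v a b).IsLink (some e) s t :=
  reduction_isLink_some.2 ⟨h, h.ne_left he, h.ne_right he⟩

lemma IsClaw.reduction_isLink_none (hc : G.IsClaw v a b c ea eb ec) :
    (G.reduction v a b).IsLink none a b :=
  Or.inr ⟨rfl, ⟨hc.link_a.right_mem, hc.ne_a⟩, ⟨hc.link_b.right_mem, hc.ne_b⟩, Or.inl ⟨rfl, rfl⟩⟩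

lemma some_mem_edgeSet_reduction :
    some e ∈ E(G.reduction v a b) ↔ e ∈ E(G) ∧ ¬ G.Inc e v := by
  constructor
  · intro h
    obtain ⟨s, t, h⟩ := exists_isLink_of_mem_edgeSet h
    obtain ⟨h, hs, ht⟩ := reduction_isLink_some.1 h
    refine ⟨h.edge_mem, fun hi => ?_⟩
    rcases hi.eq_or_eq_of_isLink h with rfl | rfl
    · exact hs rfl
    · exact ht rfl
  · rintro ⟨h, he⟩
    obtain ⟨s, t, h⟩ := exists_isLink_of_mem_edgeSet h
    exact (h.reduction he).edge_mem

lemma Avoids.reduction_conn (hA : G.Avoids v A) :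
    (G.reduction v a b).Conn (some '' A) p q ↔ G.Conn A p q := by
  have : (fun s t => ∃ e ∈ some '' A, (G.reduction v a b).IsLink e s t) =
      fun s t => ∃ e ∈ A, G.IsLink e s t := by
    ext s t
    constructor
    · rintro ⟨_, ⟨e, he, rfl⟩, h⟩
      exact ⟨e, he, (reduction_isLink_some.1 h).1⟩
    · rintro ⟨e, he, h⟩
      exact ⟨some e, ⟨e, he, rfl⟩, h.reduction (hA e he)⟩
  rw [Conn, Conn, this]

lemma Avoids.not_conn (hA : G.Avoids v A) (hq : q ≠ v) : ¬ G.Conn A v q := by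
  intro h
  rcases Relation.ReflTransGen.cases_head h with rfl | ⟨m, ⟨e, he, hl⟩, -⟩
  · exact hq rfl
  · exact hA e he hl.inc_left

lemma Avoids.conn_insert (hA : G.Avoids v A) (h : G.IsLink e v c) (hp : p ≠ v) (hq : q ≠ v) :
    G.Conn (insert e A) p q ↔ G.Conn A p q := by
  rw [conn_insert_iff h]
  have h1 := hA.not_conn hq
  have h2 : ¬ G.Conn A p v := fun h => hA.not_conn hp h.symm
  tauto

/-- In `A + e` the vertex `v` is a leaf hanging at `c`, so it can stand in for `c`. -/
lemma Avoids.conn_insert_left (hA : G.Avoids v A) (h : G.IsLink e v c) (hq : q ≠ v) :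
    G.Conn (insert e A) v q ↔ G.Conn A c q := by
  rw [conn_insert_iff h]
  have h1 := hA.not_conn hq
  have h2 := Conn.refl G A v
  tauto

/-- The path `a`, `v`, `b` is a subdivision of the split edge. -/
lemma IsClaw.conn_split (hc : G.IsClaw v a b c ea eb ec) (hA : G.Avoids v A)
    (hp : p ≠ v) (hq : q ≠ v) : G.Conn (insert ea (insert eb A)) p q ↔
      (G.reduction v a b).Conn (insert none (some '' A)) p q := by
  rw [conn_insert_iff hc.link_a, conn_insert_iff hc.reduction_isLink_none,
    hA.reduction_conn, hA.reduction_conn, hA.reduction_conn, hA.reduction_conn, hA.reduction_conn,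
    hA.conn_insert hc.link_b hp hq, conn_comm (s := p) (t := v),
    hA.conn_insert_left hc.link_b hp, hA.conn_insert_left hc.link_b hq,
    hA.conn_insert hc.link_b hp hc.ne_a, hA.conn_insert hc.link_b hc.ne_a hq,
    conn_comm (s := b) (t := p)]
  tauto

/-! ### Removing edges -/

lemma some_image_sdiff : some '' A \ {some g} = some '' (A \ {g}) := by
  rw [Set.image_sdiff (Option.some_injective β), Set.image_singleton]

lemma insert_none_sdiff_some :
    insert none (some '' A) \ {some g} = insert none (some '' (A \ {g})) := by
  rw [Set.insert_sdiff_of_notMem _ (by simp), some_image_sdiff]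

lemma insert_none_sdiff_none : insert none (some '' A) \ {none} = some '' A :=
  Set.insert_sdiff_self_of_notMem (by simp)

lemma insert_sdiff_of_ne (h : g ≠ e) : insert e A \ {g} = insert e (A \ {g}) :=
  Set.insert_sdiff_of_notMem _ (by simpa using h.symm)

namespace IsClaw

variable (hc : G.IsClaw v a b c ea eb ec)
include hc

lemma ne_of_not_inc (hg : ¬ G.Inc g v) : g ≠ ea ∧ g ≠ eb ∧ g ≠ ec := by
  refine ⟨?_, ?_, ?_⟩ <;> rintro rfl
  · exact hg hc.link_a.inc_left
  · exact hg hc.link_b.inc_left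
  · exact hg hc.link_c.inc_left

lemma split_sdiff (hg : ¬ G.Inc g v) :
    insert ea (insert eb A) \ {g} = insert ea (insert eb (A \ {g})) := by
  obtain ⟨h1, h2, -⟩ := hc.ne_of_not_inc hg
  rw [insert_sdiff_of_ne h1, insert_sdiff_of_ne h2]

lemma split_sdiff_left (hA : G.Avoids v A) : insert ea (insert eb A) \ {ea} = insert eb A :=
  Set.insert_sdiff_self_of_notMem (by simp [hc.ab, hA.notMem hc.link_a])

lemma split_sdiff_right (hA : G.Avoids v A) : insert ea (insert eb A) \ {eb} = insert ea A := by
  rw [Set.insert_comm, hc.swap.split_sdiff_left hA]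

lemma attach_sdiff (hg : ¬ G.Inc g v) : insert ec B \ {g} = insert ec (B \ {g}) :=
  insert_sdiff_of_ne (hc.ne_of_not_inc hg).2.2

lemma attach_sdiff_self (hB : G.Avoids v B) : insert ec B \ {ec} = B :=
  Set.insert_sdiff_self_of_notMem (hB.notMem hc.link_c)

/-! ### Spanning trees of the reduction graph -/

lemma edgeSet_eq : ∀ e, e ∈ E(G) ↔
    e = ea ∨ e = eb ∨ e = ec ∨ some e ∈ E(G.reduction v a b) := by
  intro e
  rw [some_mem_edgeSet_reduction]
  constructor
  · intro he
    by_cases hi : G.Inc e v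
    · have := hc.eq_of_inc e hi; tauto
    · tauto
  · rintro (rfl | rfl | rfl | he)
    exacts [hc.link_a.edge_mem, hc.link_b.edge_mem, hc.link_c.edge_mem, he.1]

lemma isSpanningTree_attach (hB : G.Avoids v B) :
    (G.reduction v a b).IsSpanningTree (some '' B) ↔ G.IsSpanningTree (insert ec B) := by
  rw [isSpanningTree_iff, isSpanningTree_iff]
  refine and_congr ?_ (and_congr ?_ (and_congr ?_ ?_))
  · rw [Set.image_subset_iff, Set.insert_subset_iff]
    constructor
    · exact fun h => ⟨hc.link_c.edge_mem, fun e he => (some_mem_edgeSet_reduction.1 (h he)).1⟩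
    · exact fun h e he => some_mem_edgeSet_reduction.2 ⟨h.2 he, hB e he⟩
  · exact iff_of_true ⟨a, hc.link_a.right_mem, hc.ne_a⟩ ⟨a, hc.link_a.right_mem⟩
  · constructor
    · intro h
      have key : ∀ s ∈ V(G), G.Conn (insert ec B) s c := by
        intro s hs
        by_cases hsv : s = v
        · subst hsv
          exact hc.link_c.conn (Set.mem_insert _ _)
        · rw [hB.conn_insert hc.link_c hsv hc.ne_c, ← hB.reduction_conn]
          exact h s ⟨hs, hsv⟩ c ⟨hc.link_c.right_mem, hc.ne_c⟩
      exact fun s hs t ht => (key s hs).trans (key t ht).symm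
    · intro h s hs t ht
      rw [hB.reduction_conn, ← hB.conn_insert hc.link_c hs.2 ht.2]
      exact h s hs.1 t ht.1
  · constructor
    · rintro h f (rfl | hf) s t hst
      · rw [hc.attach_sdiff_self hB, hst.conn_iff hc.link_c]
        exact hB.not_conn hc.ne_c
      · rw [hc.attach_sdiff (hB f hf), (hB.sdiff _).conn_insert hc.link_c (hst.ne_left (hB f hf))
          (hst.ne_right (hB f hf)), ← (hB.sdiff _).reduction_conn, ← some_image_sdiff]
        exact h _ ⟨f, hf, rfl⟩ s t (hst.reduction (hB f hf))
    · rintro h _ ⟨f, hf, rfl⟩ s t hst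
      obtain ⟨hst, hs, ht⟩ := reduction_isLink_some.1 hst
      rw [some_image_sdiff, (hB.sdiff _).reduction_conn,
        ← (hB.sdiff _).conn_insert hc.link_c hs ht, ← hc.attach_sdiff (hB f hf)]
      exact h f (Set.mem_insert_of_mem _ hf) s t hst

lemma isSpanningTree_split (hA : G.Avoids v A) :
    (G.reduction v a b).IsSpanningTree (insert none (some '' A)) ↔
      G.IsSpanningTree (insert ea (insert eb A)) := by
  rw [isSpanningTree_iff, isSpanningTree_iff]
  refine and_congr ?_ (and_congr ?_ (and_congr ?_ ?_))
  · rw [Set.insert_subset_iff, Set.image_subset_iff, Set.insert_subset_iff, Set.insert_subset_iff]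
    constructor
    · exact fun h => ⟨hc.link_a.edge_mem, hc.link_b.edge_mem,
        fun e he => (some_mem_edgeSet_reduction.1 (h.2 he)).1⟩
    · exact fun h => ⟨hc.reduction_isLink_none.edge_mem,
        fun e he => some_mem_edgeSet_reduction.2 ⟨h.2.2 he, hA e he⟩⟩
  · exact iff_of_true ⟨a, hc.link_a.right_mem, hc.ne_a⟩ ⟨a, hc.link_a.right_mem⟩
  · constructor
    · intro h
      have key : ∀ s ∈ V(G), G.Conn (insert ea (insert eb A)) s a := by
        intro s hs
        by_cases hsv : s = v
        · subst hsv
          exact hc.link_a.conn (Set.mem_insert _ _)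
        · rw [hc.conn_split hA hsv hc.ne_a]
          exact h s ⟨hs, hsv⟩ a ⟨hc.link_a.right_mem, hc.ne_a⟩
      exact fun s hs t ht => (key s hs).trans (key t ht).symm
    · intro h s hs t ht
      rw [← hc.conn_split hA hs.2 ht.2]
      exact h s hs.1 t ht.1
  · constructor
    · intro h
      have h0 := h none (Set.mem_insert _ _) a b hc.reduction_isLink_none
      rw [insert_none_sdiff_none, hA.reduction_conn] at h0
      rintro f (rfl | rfl | hf) s t hst
      · rw [hc.split_sdiff_left hA, hst.conn_iff hc.link_a, hA.conn_insert_left hc.link_b hc.ne_a]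
        exact fun h => h0 h.symm
      · rw [hc.split_sdiff_right hA, hst.conn_iff hc.link_b, hA.conn_insert_left hc.link_a hc.ne_b]
        exact h0
      · rw [hc.split_sdiff (hA f hf), hc.conn_split (hA.sdiff _) (hst.ne_left (hA f hf))
          (hst.ne_right (hA f hf)), ← insert_none_sdiff_some]
        exact h _ (Set.mem_insert_of_mem _ ⟨f, hf, rfl⟩) s t (hst.reduction (hA f hf))
    · rintro h _ (rfl | ⟨f, hf, rfl⟩) s t hst
      · rw [hst.conn_iff hc.reduction_isLink_none, insert_none_sdiff_none, hA.reduction_conn,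
          ← hA.conn_insert_left hc.link_a hc.ne_b, ← hc.split_sdiff_right hA]
        exact h eb (by simp) v b hc.link_b
      · obtain ⟨hst, hs, ht⟩ := reduction_isLink_some.1 hst
        rw [insert_none_sdiff_some, ← hc.conn_split (hA.sdiff _) hs ht, ← hc.split_sdiff (hA f hf)]
        exact h f (Set.mem_insert_of_mem _ (Set.mem_insert_of_mem _ hf)) s t hst

/-- This is the operation `ρ` in coordinates `A`, `B` free of `v`, in which all later comparisons of
`G` with its reduction are made. -/
lemma isTreePair_iff (hA : G.Avoids v A) (hB : G.Avoids v B) :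
    (G.reduction v a b).IsTreePair (insert none (some '' A)) (some '' B) ↔
      G.IsTreePair (insert ea (insert eb A)) (insert ec B) := by
  have hdis : Disjoint (insert none (some '' A)) (some '' B) ↔
      Disjoint (insert ea (insert eb A)) (insert ec B) := by
    have h1 := hA.notMem hc.link_c
    have h2 := hB.notMem hc.link_a
    have h3 := hB.notMem hc.link_b
    simp [Set.disjoint_insert_left, Set.disjoint_insert_right,
      Set.disjoint_image_iff (Option.some_injective β), h1, h2, h3, hc.ac.symm, hc.bc.symm]
  have hun : insert none (some '' A) ∪ some '' B = E(G.reduction v a b) ↔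
      insert ea (insert eb A) ∪ insert ec B = E(G) := by
    have hn : none ∈ E(G.reduction v a b) := hc.reduction_isLink_none.edge_mem
    constructor
    · intro h
      ext e
      have he : some e ∈ insert none (some '' A) ∪ some '' B ↔ e ∈ A ∨ e ∈ B := by simp
      rw [hc.edgeSet_eq, ← h, he]
      simp only [Set.mem_union, Set.mem_insert_iff]
      tauto
    · intro h
      ext e
      cases e with
      | none => simp [hn]
      | some e =>
        have he : e ∈ insert ea (insert eb A) ∪ insert ec B ↔
            e = ea ∨ e = eb ∨ e = ec ∨ e ∈ A ∨ e ∈ B := by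
          simp only [Set.mem_union, Set.mem_insert_iff]; tauto
        have he' : some e ∈ insert none (some '' A) ∪ some '' B ↔ e ∈ A ∨ e ∈ B := by simp
        rw [he', some_mem_edgeSet_reduction, ← h, he]
        constructor
        · rintro (h1 | h1)
          · exact ⟨by tauto, hA e h1⟩
          · exact ⟨by tauto, hB e h1⟩
        · rintro ⟨h1, h2⟩
          have := hc.ne_of_not_inc h2
          tauto
  exact ⟨fun h => ⟨(hc.isSpanningTree_split hA).1 h.left, (hc.isSpanningTree_attach hB).1 h.right,
      hdis.1 h.disjoint, hun.1 h.union⟩,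
    fun h => ⟨(hc.isSpanningTree_split hA).2 h.left, (hc.isSpanningTree_attach hB).2 h.right,
      hdis.2 h.disjoint, hun.2 h.union⟩⟩

end IsClaw

/-- By duality `e ∈ D(T, f')` means `f' ∈ C(T, e)`. This is the form in which the extra class is
stated. -/
lemma IsTreePair.isUniqueExchange_iff_inter (hp : G.IsTreePair S T) :
    G.IsUniqueExchange S T e f ↔
      e ∈ S ∧ f ∈ T ∧ G.fundCut S e ∩ G.fundCycle T e = {e, f} := by
  rw [hp.isUniqueExchange_iff]
  refine and_congr_right fun he => and_congr_right fun hf => ?_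
  have heE := hp.left.subset he
  have heT := hp.notMem_right he
  have key : ∀ f' ∈ T, (f' ∈ G.fundCut S e ∧ e ∈ G.fundCut T f' ↔
      f' ∈ G.fundCut S e ∩ G.fundCycle T e) := fun f' hf' => by
    rw [Set.mem_inter_iff, hp.right.mem_fundCycle_iff hf' heT heE]
  constructor
  · intro h
    ext f'
    constructor
    · intro hf'
      rcases mem_insert_of_mem_fundCycle hf'.2 with rfl | hf'T
      · exact Set.mem_insert _ _
      · exact Or.inr ((h f' hf'T).1 ((key f' hf'T).2 hf'))
    · rintro (rfl | rfl)
      · exact ⟨hp.left.self_mem_fundCut he, hp.right.self_mem_fundCycle heT heE⟩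
      · exact (key _ hf).1 ((h _ hf).2 rfl)
  · intro h f' hf'
    rw [key f' hf', h]
    simp [(hp.ne he hf').symm]

namespace IsClaw

variable (hc : G.IsClaw v a b c ea eb ec)
include hc

/-! ### Fundamental cuts of the reduction graph -/

lemma mem_fundCut_attach (hB : G.Avoids v B) (hg : ¬ G.Inc g v) (hh : h ∈ E(G))
    (hhv : ¬ G.Inc h v) : h ∈ G.fundCut (insert ec B) g ↔
      some h ∈ (G.reduction v a b).fundCut (some '' B) (some g) := by
  obtain ⟨s, t, hl⟩ := exists_isLink_of_mem_edgeSet hh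
  rw [hl.mem_fundCut_iff, (hl.reduction hhv).mem_fundCut_iff, hc.attach_sdiff hg,
    some_image_sdiff, (hB.sdiff _).reduction_conn,
    (hB.sdiff _).conn_insert hc.link_c (hl.ne_left hhv) (hl.ne_right hhv)]

/-- With `v` hanging at `c`, the edge `ea` behaves like an edge from `c` to `a`. -/
lemma left_mem_fundCut_attach (hB : G.Avoids v B) (hg : ¬ G.Inc g v) :
    ea ∈ G.fundCut (insert ec B) g ↔ ¬ G.Conn (B \ {g}) c a := by
  rw [hc.link_a.mem_fundCut_iff, hc.attach_sdiff hg,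
    (hB.sdiff _).conn_insert_left hc.link_c hc.ne_a]

lemma none_mem_fundCut (hB : G.Avoids v B) :
    none ∈ (G.reduction v a b).fundCut (some '' B) (some g) ↔ ¬ G.Conn (B \ {g}) a b := by
  rw [hc.reduction_isLink_none.mem_fundCut_iff, some_image_sdiff, (hB.sdiff _).reduction_conn]

lemma mem_fundCut_split (hA : G.Avoids v A) (hg : ¬ G.Inc g v) (hh : h ∈ E(G))
    (hhv : ¬ G.Inc h v) : h ∈ G.fundCut (insert ea (insert eb A)) g ↔
      some h ∈ (G.reduction v a b).fundCut (insert none (some '' A)) (some g) := by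
  obtain ⟨s, t, hl⟩ := exists_isLink_of_mem_edgeSet hh
  rw [hl.mem_fundCut_iff, (hl.reduction hhv).mem_fundCut_iff, hc.split_sdiff hg,
    insert_none_sdiff_some, hc.conn_split (hA.sdiff _) (hl.ne_left hhv) (hl.ne_right hhv)]

/-- Deleting `ea` leaves `v` as a leaf at `b`, which is invisible away from `v`; the same cut arises
from deleting the whole subdivided edge. -/
lemma mem_fundCut_split_left (hA : G.Avoids v A) (hh : h ∈ E(G)) (hhv : ¬ G.Inc h v) :
    h ∈ G.fundCut (insert ea (insert eb A)) ea ↔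
      some h ∈ (G.reduction v a b).fundCut (insert none (some '' A)) none := by
  obtain ⟨s, t, hl⟩ := exists_isLink_of_mem_edgeSet hh
  rw [hl.mem_fundCut_iff, (hl.reduction hhv).mem_fundCut_iff, hc.split_sdiff_left hA,
    insert_none_sdiff_none, hA.reduction_conn,
    hA.conn_insert hc.link_b (hl.ne_left hhv) (hl.ne_right hhv)]

lemma mem_fundCut_split_right (hA : G.Avoids v A) (hh : h ∈ E(G)) (hhv : ¬ G.Inc h v) :
    h ∈ G.fundCut (insert ea (insert eb A)) eb ↔
      some h ∈ (G.reduction v a b).fundCut (insert none (some '' A)) none := by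
  obtain ⟨s, t, hl⟩ := exists_isLink_of_mem_edgeSet hh
  rw [hl.mem_fundCut_iff, (hl.reduction hhv).mem_fundCut_iff, hc.split_sdiff_right hA,
    insert_none_sdiff_none, hA.reduction_conn,
    hA.conn_insert hc.link_a (hl.ne_left hhv) (hl.ne_right hhv)]

lemma attach_mem_fundCut_left (hA : G.Avoids v A) :
    ec ∈ G.fundCut (insert ea (insert eb A)) ea ↔ ¬ G.Conn A b c := by
  rw [hc.link_c.mem_fundCut_iff, hc.split_sdiff_left hA, hA.conn_insert_left hc.link_b hc.ne_c]

lemma attach_mem_fundCut_right (hA : G.Avoids v A) :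
    ec ∈ G.fundCut (insert ea (insert eb A)) eb ↔ ¬ G.Conn A a c := by
  rw [hc.link_c.mem_fundCut_iff, hc.split_sdiff_right hA, hA.conn_insert_left hc.link_a hc.ne_c]

lemma left_mem_fundCut_attach_self (hB : G.Avoids v B) : ea ∈ G.fundCut (insert ec B) ec := by
  rw [hc.link_a.mem_fundCut_iff, hc.attach_sdiff_self hB]
  exact hB.not_conn hc.ne_a

/-- Deleting the only tree edge at `v` isolates `v`, so the cut is contained in its star. -/
lemma inc_of_mem_fundCut_attach_self (hB : G.Avoids v B) (hT : G.IsSpanningTree (insert ec B))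
    (h : g ∈ G.fundCut (insert ec B) ec) : G.Inc g v := by
  by_contra hg
  obtain ⟨s, t, hl⟩ := exists_isLink_of_mem_edgeSet (edge_mem_of_mem_fundCut h)
  rw [hl.mem_fundCut_iff, hc.attach_sdiff_self hB,
    ← hB.conn_insert hc.link_c (hl.ne_left hg) (hl.ne_right hg)] at h
  exact h (hT.conn hl.left_mem hl.right_mem)

lemma left_mem_fundCycle_iff (hA : G.Avoids v A)
    (hp : G.IsTreePair (insert ea (insert eb A)) (insert ec B)) :
    ea ∈ G.fundCycle (insert ea (insert eb A)) ec ↔ ¬ G.Conn A b c := by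
  rw [hp.left.mem_fundCycle_iff (by simp) (hp.notMem_left (by simp)) hc.link_c.edge_mem,
    hc.attach_mem_fundCut_left hA]

lemma right_mem_fundCycle_iff (hA : G.Avoids v A)
    (hp : G.IsTreePair (insert ea (insert eb A)) (insert ec B)) :
    eb ∈ G.fundCycle (insert ea (insert eb A)) ec ↔ ¬ G.Conn A a c := by
  rw [hp.left.mem_fundCycle_iff (by simp) (hp.notMem_left (by simp)) hc.link_c.edge_mem,
    hc.attach_mem_fundCut_right hA]

/-! ### Unique exchanges of the reduction graph -/

section

variable (hA : G.Avoids v A) (hB : G.Avoids v B)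
  (hp : G.IsTreePair (insert ea (insert eb A)) (insert ec B))
include hA hB hp

lemma exchange_split_iff (he : ¬ G.Inc e v) (hf : ¬ G.Inc f v) :
    G.IsUniqueExchange (insert ea (insert eb A)) (insert ec B) e f ↔
      (G.reduction v a b).IsUniqueExchange (insert none (some '' A)) (some '' B)
        (some e) (some f) := by
  have hp₀ := (hc.isTreePair_iff hA hB).2 hp
  rw [hp.isUniqueExchange_iff, hp₀.isUniqueExchange_iff]
  have he' := hc.ne_of_not_inc he
  have hf' := hc.ne_of_not_inc hf
  have key : ∀ f' ∈ B, e ∈ A →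
      ((f' ∈ G.fundCut (insert ea (insert eb A)) e ∧ e ∈ G.fundCut (insert ec B) f') ↔
      (some f' ∈ (G.reduction v a b).fundCut (insert none (some '' A)) (some e) ∧
        some e ∈ (G.reduction v a b).fundCut (some '' B) (some f'))) := by
    intro f' hf' heA
    rw [hc.mem_fundCut_split hA he (hp.right.subset (Set.mem_insert_of_mem _ hf')) (hB f' hf'),
      hc.mem_fundCut_attach hB (hB f' hf') (hp.left.subset (by simp [heA])) he]
  constructor
  · rintro ⟨h1, h2, h3⟩
    have heA : e ∈ A := by simpa [he'.1, he'.2.1] using h1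
    have hfB : f ∈ B := by simpa [hf'.2.2] using h2
    refine ⟨by simp [heA], by simp [hfB], ?_⟩
    rintro _ ⟨f', hf', rfl⟩
    rw [← key f' hf' heA, h3 f' (Set.mem_insert_of_mem _ hf'), Option.some_inj]
  · rintro ⟨h1, h2, h3⟩
    have heA : e ∈ A := by simpa using h1
    have hfB : f ∈ B := by simpa using h2
    refine ⟨by simp [heA], by simp [hfB], ?_⟩
    rintro f' (rfl | hf'')
    -- The only candidate without a counterpart in the reduction is `ec`; its cut is the star of
    -- `v`, which `e` avoids.
    · refine iff_of_false (fun h => he ?_) hf'.2.2.symm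
      exact hc.inc_of_mem_fundCut_attach_self hB hp.right h.2
    · rw [key f' hf'' heA, h3 _ ⟨f', hf'', rfl⟩, Option.some_inj]

/-- The candidates in `A` agree; what differs is `none` on one side and `ea`, `eb` on the other.
Ruling out `ea` and `eb` rules out `none`; the converse fails only when both cross the cut of `e`.
-/
lemma exchange_attach_iff (he : ¬ G.Inc e v) (hf : ¬ G.Inc f v) :
    G.IsUniqueExchange (insert ec B) (insert ea (insert eb A)) e f ↔
      (G.reduction v a b).IsUniqueExchange (some '' B) (insert none (some '' A))
        (some e) (some f) ∧
      ¬ (some e ∈ (G.reduction v a b).fundCut (insert none (some '' A)) none ∧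
        ea ∈ G.fundCut (insert ec B) e ∧ eb ∈ G.fundCut (insert ec B) e) := by
  have hp₀ := (hc.isTreePair_iff hA hB).2 hp
  rw [hp.symm.isUniqueExchange_iff, hp₀.symm.isUniqueExchange_iff]
  have he' := hc.ne_of_not_inc he
  have hf' := hc.ne_of_not_inc hf
  have key : ∀ f' ∈ A, e ∈ B →
      ((f' ∈ G.fundCut (insert ec B) e ∧ e ∈ G.fundCut (insert ea (insert eb A)) f') ↔
      (some f' ∈ (G.reduction v a b).fundCut (some '' B) (some e) ∧
        some e ∈ (G.reduction v a b).fundCut (insert none (some '' A)) (some f'))) := by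
    intro f' hf' heB
    rw [hc.mem_fundCut_split hA (hA f' hf') (hp.right.subset (Set.mem_insert_of_mem _ heB)) he,
      hc.mem_fundCut_attach hB he (hp.left.subset (by simp [hf'])) (hA f' hf')]
  have ka := hc.left_mem_fundCut_attach hB he
  have kb := hc.swap.left_mem_fundCut_attach hB he
  have kn := hc.none_mem_fundCut hB (g := e)
  constructor
  · rintro ⟨h1, h2, h3⟩
    have heB : e ∈ B := by simpa [he'.2.2] using h1
    have hfA : f ∈ A := by simpa [hf'.1, hf'.2.1] using h2
    have heE := hp.right.subset h1
    have h4 := h3 ea (by simp)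
    have h5 := h3 eb (by simp)
    rw [hc.mem_fundCut_split_left hA heE he] at h4
    rw [hc.mem_fundCut_split_right hA heE he] at h5
    have na := fun h => hf'.1.symm (h4.1 h)
    have nb := fun h => hf'.2.1.symm (h5.1 h)
    refine ⟨⟨by simp [heB], by simp [hfA], ?_⟩, fun h => na ⟨h.2.1, h.1⟩⟩
    rintro _ (rfl | ⟨f', hf', rfl⟩)
    · refine iff_of_false (fun h => kn.1 h.1 ?_) (by simp)
      -- As neither `ea` nor `eb` is a candidate, `B - e` connects `c` to both `a` and `b`, hence
      -- `a` to `b`.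
      exact (not_not.1 fun h' => na ⟨ka.2 h', h.2⟩).symm.trans
        (not_not.1 fun h' => nb ⟨kb.2 h', h.2⟩)
    · rw [← key f' hf' heB, h3 f' (by simp [hf']), Option.some_inj]
  · rintro ⟨⟨h1, h2, h3⟩, h4⟩
    have heB : e ∈ B := by simpa using h1
    have hfA : f ∈ A := by simpa using h2
    have heE := hp.right.subset (Set.mem_insert_of_mem _ heB)
    have h5 := h3 none (by simp)
    have hab : some e ∈ (G.reduction v a b).fundCut (insert none (some '' A)) none →
        G.Conn (B \ {e}) a b :=
      fun hx => not_not.1 fun h' => Option.some_ne_none f (h5.1 ⟨kn.2 h', hx⟩).symm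
    refine ⟨by simp [heB], by simp [hfA], ?_⟩
    rintro f' (rfl | rfl | hf'')
    · refine iff_of_false ?_ hf'.1.symm
      rw [hc.mem_fundCut_split_left hA heE he]
      -- Since `none` is no candidate, `a` and `b` are on the same side, so if `ea` crosses then
      -- `eb` does too, and the exchange is broken.
      exact fun ⟨h, hx⟩ => h4 ⟨hx, h, kb.2 fun h7 => ka.1 h (h7.trans (hab hx).symm)⟩
    · refine iff_of_false ?_ hf'.2.1.symm
      rw [hc.mem_fundCut_split_right hA heE he]
      exact fun ⟨h, hx⟩ => h4 ⟨hx, ka.2 fun h7 => kb.1 h (h7.trans (hab hx)), h⟩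
    · rw [key f' hf'' heB, h3 _ (by simp [hf'']), Option.some_inj]

/-- A unique exchange with the split edge is forwarded to exactly one edge at `v`. -/
lemma existsUnique_forward (hu : (G.reduction v a b).IsUniqueExchange (some '' B)
    (insert none (some '' A)) (some g) none) :
    ∃! e₂, (e₂ = ea ∨ e₂ = eb) ∧ e₂ ∈ G.fundCut (insert ec B) g := by
  have hp₀ := (hc.isTreePair_iff hA hB).2 hp
  have hT := hp₀.right
  rw [hp₀.symm.isUniqueExchange_iff] at hu
  obtain ⟨h1, h2, h3⟩ := hu
  have hgB : g ∈ B := by simpa using h1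
  have hab := ((h3 none h2).2 rfl).1
  rw [hc.none_mem_fundCut hB] at hab
  have ka := hc.left_mem_fundCut_attach hB (hB g hgB)
  have kb := hc.swap.left_mem_fundCut_attach hB (hB g hgB)
  have key := hT.conn_of_not_conn h1 (p := a) (q := c) (r := b)
    ⟨hc.link_a.right_mem, hc.ne_a⟩ ⟨hc.link_c.right_mem, hc.ne_c⟩ ⟨hc.link_b.right_mem, hc.ne_b⟩
  rw [some_image_sdiff, (hB.sdiff _).reduction_conn, (hB.sdiff _).reduction_conn,
    (hB.sdiff _).reduction_conn, conn_comm (s := a) (t := c)] at key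
  by_cases h4 : G.Conn (B \ {g}) c a
  · have h5 : ¬ G.Conn (B \ {g}) c b := fun h => hab (h4.symm.trans h)
    refine ⟨eb, ⟨Or.inr rfl, kb.2 h5⟩, ?_⟩
    rintro e₂ ⟨rfl | rfl, h6⟩
    · exact absurd h4 (ka.1 h6)
    · rfl
  · refine ⟨ea, ⟨Or.inl rfl, ka.2 h4⟩, ?_⟩
    rintro e₂ ⟨rfl | rfl, h6⟩
    · rfl
    · exact absurd (key h4 (kb.1 h6)) hab

/-- Both `ea` and `eb` have `g` in their cuts because `none` does, so the cut of `g` alone chooses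
between them. Edges of `A` stay excluded, `none` being the unique target in the reduction. -/
lemma exchange_of_forward (hu : (G.reduction v a b).IsUniqueExchange (some '' B)
    (insert none (some '' A)) (some g) none) {e₂ : β} (he₂ : e₂ = ea ∨ e₂ = eb)
    (hcut : e₂ ∈ G.fundCut (insert ec B) g) :
    G.IsUniqueExchange (insert ec B) (insert ea (insert eb A)) g e₂ := by
  have huniq := hc.existsUnique_forward hA hB hp hu
  have hp₀ := (hc.isTreePair_iff hA hB).2 hp
  rw [hp₀.symm.isUniqueExchange_iff] at hu
  rw [hp.symm.isUniqueExchange_iff]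
  obtain ⟨h1, h2, h3⟩ := hu
  have hgB : g ∈ B := by simpa using h1
  have hg := hB g hgB
  have hgE := hp.right.subset (Set.mem_insert_of_mem _ hgB)
  have hn := ((h3 none h2).2 rfl).2
  refine ⟨by simp [hgB], by simp only [Set.mem_insert_iff]; tauto, ?_⟩
  have keyab : ∀ f', (f' = ea ∨ f' = eb) →
      ((f' ∈ G.fundCut (insert ec B) g ∧ g ∈ G.fundCut (insert ea (insert eb A)) f') ↔
        f' = e₂) := by
    intro f' hf'
    constructor
    · exact fun h => huniq.unique ⟨hf', h.1⟩ ⟨he₂, hcut⟩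
    · rintro rfl
      refine ⟨hcut, ?_⟩
      rcases hf' with rfl | rfl
      · exact (hc.mem_fundCut_split_left hA hgE hg).2 hn
      · exact (hc.mem_fundCut_split_right hA hgE hg).2 hn
  rintro f' (rfl | rfl | hf')
  · exact keyab _ (Or.inl rfl)
  · exact keyab _ (Or.inr rfl)
  · rw [hc.mem_fundCut_split hA (hA f' hf') hgE hg,
      hc.mem_fundCut_attach hB hg (hp.left.subset (by simp [hf'])) (hA f' hf'),
      h3 _ (by simp [hf'])]
    refine iff_of_false (by simp) ?_
    rintro rfl
    rcases he₂ with rfl | rfl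
    · exact hA.notMem hc.link_a hf'
    · exact hA.notMem hc.link_b hf'

lemma forward_of_exchange {e₂ : β} (he₂ : e₂ = ea ∨ e₂ = eb) (hg : ¬ G.Inc g v)
    (hu : G.IsUniqueExchange (insert ec B) (insert ea (insert eb A)) g e₂) :
    (G.reduction v a b).IsUniqueExchange (some '' B) (insert none (some '' A)) (some g) none := by
  have hp₀ := (hc.isTreePair_iff hA hB).2 hp
  rw [hp.symm.isUniqueExchange_iff] at hu
  rw [hp₀.symm.isUniqueExchange_iff]
  obtain ⟨h1, h2, h3⟩ := hu
  have hgB : g ∈ B := by simpa [(hc.ne_of_not_inc hg).2.2] using h1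
  have hgE := hp.right.subset h1
  have h4 := h3 ea (by simp)
  have h5 := h3 eb (by simp)
  rw [hc.mem_fundCut_split_left hA hgE hg, hc.left_mem_fundCut_attach hB hg] at h4
  rw [hc.mem_fundCut_split_right hA hgE hg, hc.swap.left_mem_fundCut_attach hB hg] at h5
  refine ⟨by simp [hgB], by simp, ?_⟩
  rintro _ (rfl | ⟨f', hf', rfl⟩)
  · refine iff_of_true ?_ rfl
    rw [hc.none_mem_fundCut hB]
    have hab := hc.ab
    have hab' := hc.ab.symm
    have kt' : G.Conn (B \ {g}) c a → G.Conn (B \ {g}) a b → G.Conn (B \ {g}) c b := Conn.trans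
    have kt'' : G.Conn (B \ {g}) c b → G.Conn (B \ {g}) a b → G.Conn (B \ {g}) c a :=
      fun h1 h2 => h1.trans h2.symm
    -- Only one of `ea`, `eb` is a candidate, so `c` is connected to exactly one of `a`, `b`, and
    -- `none` crosses the cut of `g`.
    rcases he₂ with rfl | rfl <;> tauto
  · rw [← hc.mem_fundCut_split hA (hA f' hf') hgE hg,
      ← hc.mem_fundCut_attach hB hg (hp.left.subset (by simp [hf'])) (hA f' hf'),
      h3 _ (by simp [hf'])]
    refine iff_of_false ?_ (by simp)
    rintro rfl
    rcases he₂ with rfl | rfl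
    · exact hA.notMem hc.link_a hf'
    · exact hA.notMem hc.link_b hf'

/-! ### Exchanges at the vertex -/

/-- Exactly one of the two edges in the same tree is the cycle edge. -/
lemma right_mem_fundCycle_iff_left_notMem :
    eb ∈ G.fundCycle (insert ea (insert eb A)) ec ↔
      ea ∉ G.fundCycle (insert ea (insert eb A)) ec := by
  have hT := ((hc.isTreePair_iff hA hB).2 hp).left
  rw [hc.left_mem_fundCycle_iff hA hp, hc.right_mem_fundCycle_iff hA hp, not_not]
  -- `A` has two components on `G - v`, one with `a` and one with `b`; `c` lies in exactly one of
  -- them.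
  have h1 := hT.not_conn (Set.mem_insert _ _) hc.reduction_isLink_none
  have h2 := hT.conn_or (Set.mem_insert _ _) hc.reduction_isLink_none (p := c)
    ⟨hc.link_c.right_mem, hc.ne_c⟩
  rw [insert_none_sdiff_none] at h1 h2
  rw [hA.reduction_conn] at h1 h2
  rw [hA.reduction_conn, conn_comm (s := c) (t := a), conn_comm (s := c) (t := b)] at h2
  have h3 : G.Conn A b c → G.Conn A a c → G.Conn A a b := fun h h' => h'.trans h.symm
  tauto

/-- Only edges at `v` cross the cut of `ec`, and of `ea`, `eb` only the cycle edge has `ec` in its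
own cut. -/
lemma leaf_exchange (ha : ea ∈ G.fundCycle (insert ea (insert eb A)) ec) :
    G.IsUniqueExchange (insert ec B) (insert ea (insert eb A)) ec ea := by
  have hb := hc.right_mem_fundCycle_iff_left_notMem hA hB hp
  have hecP : ec ∉ insert ea (insert eb A) := hp.notMem_left (by simp)
  rw [hp.left.mem_fundCycle_iff (by simp) hecP hc.link_c.edge_mem] at ha hb
  rw [hp.left.mem_fundCycle_iff (by simp) hecP hc.link_c.edge_mem] at hb
  rw [hp.symm.isUniqueExchange_iff]
  refine ⟨by simp, by simp, ?_⟩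
  rintro f' (rfl | rfl | hf')
  · exact iff_of_true ⟨hc.left_mem_fundCut_attach_self hB, ha⟩ rfl
  · exact iff_of_false (fun h => hb.1 h.2 ha) hc.ab.symm
  · refine iff_of_false (fun h => hA f' hf' (hc.inc_of_mem_fundCut_attach_self hB hp.right h.1)) ?_
    rintro rfl
    exact hA.notMem hc.link_a hf'

lemma mem_fundCycle_of_leaf_exchange
    (hu : G.IsUniqueExchange (insert ec B) (insert ea (insert eb A)) ec f) :
    (f = ea ∨ f = eb) ∧ f ∈ G.fundCycle (insert ea (insert eb A)) ec := by
  rw [hp.symm.isUniqueExchange_iff] at hu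
  obtain ⟨-, h2, h3⟩ := hu
  obtain ⟨h4, h5⟩ := (h3 f h2).2 rfl
  refine ⟨?_, (hp.left.mem_fundCycle_iff h2 (hp.notMem_left (by simp)) hc.link_c.edge_mem).2 h5⟩
  rcases h2 with h2 | h2 | h2
  · exact Or.inl h2
  · exact Or.inr h2
  · exact absurd (hc.inc_of_mem_fundCut_attach_self hB hp.right h4) (hA f h2)

lemma mem_fundCycle_of_extra_exchange
    (hu : G.IsUniqueExchange (insert ea (insert eb A)) (insert ec B) g ec) :
    (g = ea ∨ g = eb) ∧ g ∈ G.fundCycle (insert ea (insert eb A)) ec := by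
  rw [hp.isUniqueExchange_iff] at hu
  obtain ⟨h1, h2, h3⟩ := hu
  obtain ⟨h4, h5⟩ := (h3 ec h2).2 rfl
  refine ⟨?_, (hp.left.mem_fundCycle_iff h1 (hp.notMem_left (by simp)) hc.link_c.edge_mem).2 h4⟩
  rcases h1 with h1 | h1 | h1
  · exact Or.inl h1
  · exact Or.inr h1
  · exact absurd (hc.inc_of_mem_fundCut_attach_self hB hp.right h5) (hA g h1)

end

end IsClaw

/-! ### Tree pairs of the graph and of its reductions -/

lemma preimage_insert_none : some ⁻¹' (insert none (some '' A)) = A := by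
  ext; simp

lemma preimage_some_image : some ⁻¹' (some '' A) = A :=
  Set.preimage_image_eq _ (Option.some_injective β)

lemma insert_none_preimage {S₀ : Set (Option β)} (h : none ∈ S₀) :
    insert none (some '' (some ⁻¹' S₀)) = S₀ := by
  ext x
  cases x <;> simp [h]

lemma image_preimage_some {S₀ : Set (Option β)} (h : none ∉ S₀) :
    some '' (some ⁻¹' S₀) = S₀ := by
  ext x
  cases x <;> simp [h]

lemma union_pair : A ∪ {ea, eb} = insert ea (insert eb A) := by
  ext; simp only [Set.mem_union, Set.mem_insert_iff, Set.mem_singleton_iff]; tauto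

lemma rho_split : rho ea eb ec (insert none (some '' A)) (some '' B) =
    (insert ea (insert eb A), insert ec B) := by
  rw [rho, if_pos (Set.mem_insert _ _), preimage_insert_none, preimage_some_image, union_pair,
    Set.union_singleton]

lemma rho_attach : rho ea eb ec (some '' B) (insert none (some '' A)) =
    (insert ec B, insert ea (insert eb A)) := by
  rw [rho, if_neg (by simp), preimage_insert_none, preimage_some_image, union_pair,
    Set.union_singleton]

lemma exchange_of_mem (he : e ∈ S) :
    exchange e f S T = (insert f (S \ {e}), insert e T \ {f}) := if_pos he

lemma exchange_of_notMem (he : e ∉ S) :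
    exchange e f S T = (insert e S \ {f}, insert f (T \ {e})) := if_neg he

lemma pairCut_comm : G.pairCut S T e = G.pairCut T S e := by
  ext; exact or_comm

lemma pairCycle_comm : G.pairCycle S T e = G.pairCycle T S e := by
  ext; exact or_comm

lemma IsTreePair.pairCut_eq (h : G.IsTreePair S T) (he : e ∈ S) :
    G.pairCut S T e = G.fundCut S e := by
  ext f
  simp [pairCut, he, h.notMem_right he]

lemma IsTreePair.pairCycle_eq (h : G.IsTreePair S T) (he : e ∈ S) :
    G.pairCycle S T e = G.fundCycle T e := by
  ext f
  simp [pairCycle, he, h.notMem_right he]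

lemma HasRoles.symm (h : G.HasRoles ea eb ec S T) : G.HasRoles ea eb ec T S :=
  ⟨h.1.symm, h.2.1.symm, by rw [pairCycle_comm]; exact h.2.2.1,
    by rw [pairCycle_comm]; exact h.2.2.2⟩

lemma NotBroken.symm {H : Graph α (Option β)} {S₀ T₀ : Set (Option β)}
    (h : G.NotBroken H ea eb ec e S₀ T₀) : G.NotBroken H ea eb ec e T₀ S₀ := Or.symm h

lemma IsTreePair.isForwardEdge_split_iff {e₂ : β}
    (hp : G.IsTreePair (insert ea (insert eb A)) (insert ec B)) (hg : g ∈ B) :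
    G.IsForwardEdge ea eb ec g (insert none (some '' A)) (some '' B) e₂ ↔
      (e₂ = ea ∨ e₂ = eb) ∧ e₂ ∈ G.fundCut (insert ec B) g := by
  rw [IsForwardEdge, rho_split, pairCut_comm, hp.symm.pairCut_eq (Set.mem_insert_of_mem _ hg)]

lemma IsTreePair.isForwardEdge_attach_iff {e₂ : β}
    (hp : G.IsTreePair (insert ea (insert eb A)) (insert ec B)) (hg : g ∈ B) :
    G.IsForwardEdge ea eb ec g (some '' B) (insert none (some '' A)) e₂ ↔
      (e₂ = ea ∨ e₂ = eb) ∧ e₂ ∈ G.fundCut (insert ec B) g := by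
  rw [IsForwardEdge, rho_attach, hp.symm.pairCut_eq (Set.mem_insert_of_mem _ hg)]

namespace IsClaw

variable (hc : G.IsClaw v a b c ea eb ec)
include hc

lemma exists_of_none_mem {S₀ T₀ : Set (Option β)}
    (h : (G.reduction v a b).IsTreePair S₀ T₀) (hn : none ∈ S₀) :
    ∃ A B, G.Avoids v A ∧ G.Avoids v B ∧
      G.IsTreePair (insert ea (insert eb A)) (insert ec B) ∧
      S₀ = insert none (some '' A) ∧ T₀ = some '' B := by
  have hS := insert_none_preimage hn
  have hT := image_preimage_some (h.notMem_right hn)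
  have hA : G.Avoids v (some ⁻¹' S₀) :=
    fun e he => (some_mem_edgeSet_reduction.1 (h.left.subset he)).2
  have hB : G.Avoids v (some ⁻¹' T₀) :=
    fun e he => (some_mem_edgeSet_reduction.1 (h.right.subset he)).2
  refine ⟨_, _, hA, hB, ?_, hS.symm, hT.symm⟩
  rw [← hc.isTreePair_iff hA hB, hS, hT]
  exact h

lemma exists_of_reduction {S₀ T₀ : Set (Option β)}
    (h : (G.reduction v a b).IsTreePair S₀ T₀) :
    ∃ A B, G.Avoids v A ∧ G.Avoids v B ∧
      G.IsTreePair (insert ea (insert eb A)) (insert ec B) ∧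
      ((S₀ = insert none (some '' A) ∧ T₀ = some '' B) ∨
        (S₀ = some '' B ∧ T₀ = insert none (some '' A))) := by
  rcases h.mem_or_mem hc.reduction_isLink_none.edge_mem with hn | hn
  · obtain ⟨A, B, hA, hB, hp, h1, h2⟩ := hc.exists_of_none_mem h hn
    exact ⟨A, B, hA, hB, hp, Or.inl ⟨h1, h2⟩⟩
  · obtain ⟨A, B, hA, hB, hp, h1, h2⟩ := hc.exists_of_none_mem h.symm hn
    exact ⟨A, B, hA, hB, hp, Or.inr ⟨h2, h1⟩⟩

lemma exists_of_mem (h : G.IsTreePair S T) (ha : ea ∈ S) (hb : eb ∈ S) (hcT : ec ∈ T) :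
    ∃ A B, G.Avoids v A ∧ G.Avoids v B ∧ S = insert ea (insert eb A) ∧ T = insert ec B := by
  refine ⟨S \ {ea, eb}, T \ {ec}, ?_, ?_, ?_, (Set.insert_sdiff_self_of_mem hcT).symm⟩
  · rintro e ⟨he, hne⟩ hi
    rcases hc.eq_of_inc e hi with rfl | rfl | rfl
    · simp at hne
    · simp at hne
    · exact h.notMem_right he hcT
  · rintro e ⟨he, hne⟩ hi
    rcases hc.eq_of_inc e hi with rfl | rfl | rfl
    · exact h.notMem_right ha he
    · exact h.notMem_right hb he
    · simp at hne
  · ext e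
    simp only [Set.mem_insert_iff, Set.mem_sdiff, Set.mem_singleton_iff]
    by_cases h1 : e = ea <;> by_cases h2 : e = eb <;> simp_all

/-- A spanning tree contains an edge at `v`. -/
lemma exists_mem (h : G.IsSpanningTree T) : ea ∈ T ∨ eb ∈ T ∨ ec ∈ T := by
  by_contra! hcon
  refine Avoids.not_conn (G := G) (v := v) (A := T) ?_ hc.ne_a
    (h.conn hc.link_a.left_mem hc.link_a.right_mem)
  intro e he hi
  rcases hc.eq_of_inc e hi with rfl | rfl | rfl
  exacts [hcon.1 he, hcon.2.1 he, hcon.2.2 he]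

/-- Duality turns the two cycle conditions into the cut conditions of `exchange_attach_iff`. -/
lemma notBroken_iff (hp : G.IsTreePair (insert ea (insert eb A)) (insert ec B))
    (he : e ∈ insert ec B) :
    G.NotBroken (G.reduction v a b) ea eb ec e (insert none (some '' A)) (some '' B) ↔
      ¬ (some e ∈ (G.reduction v a b).fundCut (insert none (some '' A)) none ∧
        ea ∈ G.fundCut (insert ec B) e ∧ eb ∈ G.fundCut (insert ec B) e) := by
  rw [NotBroken, preimage_some_image, Set.union_singleton,
    hp.right.mem_fundCycle_iff he (hp.notMem_right (by simp)) hc.link_a.edge_mem,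
    hp.right.mem_fundCycle_iff he (hp.notMem_right (by simp)) hc.link_b.edge_mem]
  simp

section

variable (hA : G.Avoids v A) (hB : G.Avoids v B)
  (hp : G.IsTreePair (insert ea (insert eb A)) (insert ec B))
include hA hB hp

lemma notBroken_of_mem (he : e ∈ A) :
    G.NotBroken (G.reduction v a b) ea eb ec e (insert none (some '' A)) (some '' B) := by
  refine Or.inl ⟨Set.mem_insert _ _, fun h => ?_⟩
  exact ((hc.isTreePair_iff hA hB).2 hp).left.not_mem_fundCut (by simp [he]) (by simp) h.1

/-- Unbroken unique exchanges of the reduction graph are the unique exchanges avoiding `v`. -/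
lemma isTauArc_lifted_iff : (G.IsTauArc e f (insert ea (insert eb A)) (insert ec B) ∧
      ¬ G.Inc e v ∧ ¬ G.Inc f v) ↔
    (G.reduction v a b).IsTauArc (some e) (some f) (insert none (some '' A)) (some '' B) ∧
      G.NotBroken (G.reduction v a b) ea eb ec e (insert none (some '' A)) (some '' B) := by
  have hp₀ := (hc.isTreePair_iff hA hB).2 hp
  constructor
  · rintro ⟨⟨-, hu | hu⟩, he, hf⟩
    · have heA : e ∈ A := by
        simpa [(hc.ne_of_not_inc he).1, (hc.ne_of_not_inc he).2.1] using hu.1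
      exact ⟨⟨hp₀, Or.inl ((hc.exchange_split_iff hA hB hp he hf).1 hu)⟩,
        hc.notBroken_of_mem hA hB hp heA⟩
    · have h := (hc.exchange_attach_iff hA hB hp he hf).1 hu
      exact ⟨⟨hp₀, Or.inr h.1⟩, (hc.notBroken_iff hp hu.1).2 h.2⟩
  · rintro ⟨⟨-, hu⟩, hb⟩
    have hE : ∀ g, some g ∈ insert none (some '' A) ∨ some g ∈ some '' B → ¬ G.Inc g v := by
      rintro g (hg | hg)
      · exact hA g (by simpa using hg)
      · exact hB g (by simpa using hg)
    have he : ¬ G.Inc e v := hE e (hu.imp (·.1) (·.1))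
    have hf : ¬ G.Inc f v := hE f (hu.symm.imp (·.2.1) (·.2.1))
    refine ⟨⟨hp, ?_⟩, he, hf⟩
    rcases hu with hu | hu
    · exact Or.inl ((hc.exchange_split_iff hA hB hp he hf).2 hu)
    · have heB : e ∈ insert ec B := Set.mem_insert_of_mem _ (by simpa using hu.1)
      exact Or.inr ((hc.exchange_attach_iff hA hB hp he hf).2 ⟨hu, (hc.notBroken_iff hp heB).1 hb⟩)

/-- The condition on the non-cycle edge is automatic, since exactly one of `ea`, `eb` lies on the
cycle. -/
lemma hasRoles_iff : G.HasRoles ea eb ec (insert ea (insert eb A)) (insert ec B) ↔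
    ea ∈ G.fundCycle (insert ea (insert eb A)) ec := by
  have h := hc.right_mem_fundCycle_iff_left_notMem hA hB hp
  rw [HasRoles, pairCycle_comm, hp.symm.pairCycle_eq (Set.mem_insert _ _), h]
  simp [hp]

end

/-- Normal form of the tree pairs of the reduction graph with a unique exchange targeting the split
edge. -/
lemma exists_of_isTauArc_none {S₀ T₀ : Set (Option β)}
    (h : (G.reduction v a b).IsTauArc (some g) none S₀ T₀) :
    ∃ A B, G.Avoids v A ∧ G.Avoids v B ∧
      G.IsTreePair (insert ea (insert eb A)) (insert ec B) ∧ g ∈ B ∧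
      (G.reduction v a b).IsUniqueExchange (some '' B) (insert none (some '' A)) (some g) none ∧
      ((S₀ = insert none (some '' A) ∧ T₀ = some '' B) ∨
        (S₀ = some '' B ∧ T₀ = insert none (some '' A))) := by
  have key : ∀ {S₀ T₀}, (G.reduction v a b).IsTreePair S₀ T₀ →
      (G.reduction v a b).IsUniqueExchange T₀ S₀ (some g) none →
      ∃ A B, G.Avoids v A ∧ G.Avoids v B ∧
        G.IsTreePair (insert ea (insert eb A)) (insert ec B) ∧ g ∈ B ∧
        (G.reduction v a b).IsUniqueExchange (some '' B) (insert none (some '' A)) (some g) none ∧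
        (S₀ = insert none (some '' A) ∧ T₀ = some '' B) := by
    intro S₀ T₀ h hu
    obtain ⟨A, B, hA, hB, hp, rfl, rfl⟩ := hc.exists_of_none_mem h hu.2.1
    exact ⟨A, B, hA, hB, hp, by simpa using hu.1, hu, rfl, rfl⟩
  rcases h.2 with hu | hu
  · obtain ⟨A, B, hA, hB, hp, hg, hu', h1, h2⟩ := key h.1.symm hu
    exact ⟨A, B, hA, hB, hp, hg, hu', Or.inr ⟨h2, h1⟩⟩
  · obtain ⟨A, B, hA, hB, hp, hg, hu', h1⟩ := key h.1 hu
    exact ⟨A, B, hA, hB, hp, hg, hu', Or.inl h1⟩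

lemma existsUnique_isForwardEdge {S₀ T₀ : Set (Option β)}
    (h : (G.reduction v a b).IsTauArc (some g) none S₀ T₀) :
    ∃! e₂, G.IsForwardEdge ea eb ec g S₀ T₀ e₂ := by
  obtain ⟨A, B, hA, hB, hp, hg, hu, ⟨rfl, rfl⟩ | ⟨rfl, rfl⟩⟩ := hc.exists_of_isTauArc_none h
  · simp only [hp.isForwardEdge_split_iff hg]
    exact hc.existsUnique_forward hA hB hp hu
  · simp only [hp.isForwardEdge_attach_iff hg]
    exact hc.existsUnique_forward hA hB hp hu

lemma isTauArc_forward {S₀ T₀ : Set (Option β)} {e₂ : β}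
    (h : (G.reduction v a b).IsTauArc (some g) none S₀ T₀)
    (h₂ : G.IsForwardEdge ea eb ec g S₀ T₀ e₂) :
    G.IsTauArc g e₂ (rho ea eb ec S₀ T₀).1 (rho ea eb ec S₀ T₀).2 ∧ ¬ G.Inc g v := by
  obtain ⟨A, B, hA, hB, hp, hg, hu, ⟨rfl, rfl⟩ | ⟨rfl, rfl⟩⟩ := hc.exists_of_isTauArc_none h
  · rw [hp.isForwardEdge_split_iff hg] at h₂
    rw [rho_split]
    exact ⟨⟨hp, Or.inr (hc.exchange_of_forward hA hB hp hu h₂.1 h₂.2)⟩, hB g hg⟩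
  · rw [hp.isForwardEdge_attach_iff hg] at h₂
    rw [rho_attach]
    exact ⟨⟨hp.symm, Or.inl (hc.exchange_of_forward hA hB hp hu h₂.1 h₂.2)⟩, hB g hg⟩

end IsClaw

/-- The reverse of a unique exchange is a unique exchange. -/
lemma IsTauArc.reverse (h : G.IsTauArc e f S T) :
    G.IsTauArc f e (exchange e f S T).1 (exchange e f S T).2 := by
  obtain ⟨hp, hu | hu⟩ := h
  · rw [exchange_of_mem hu.1]
    exact ⟨hu.2.2.1, Or.inl (hu.reverse hp)⟩
  · rw [exchange_of_notMem (hp.notMem_left hu.1)]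
    exact ⟨hu.2.2.1.symm, Or.inr (hu.reverse hp.symm)⟩

lemma IsTreePair.exchange_swap (hp : G.IsTreePair S T) (he : e ∈ E(G)) :
    exchange e f T S = (exchange e f S T).swap := by
  rcases hp.mem_or_mem he with h | h
  · rw [exchange_of_mem h, exchange_of_notMem (hp.notMem_right h), Prod.swap]
  · rw [exchange_of_mem h, exchange_of_notMem (hp.notMem_left h), Prod.swap]

/-! ### The four classes -/

lemma Distinct.eq_or (h : Distinct i j k) (m : Fin 3) : m = i ∨ m = j ∨ m = k := by
  obtain ⟨h1, h2, h3⟩ := h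
  omega

lemma Distinct.swap (h : Distinct i j k) : Distinct j i k := ⟨h.1.symm, h.2.2, h.2.1⟩

lemma Distinct.rotate (h : Distinct i j k) : Distinct j k i := ⟨h.2.2, h.1.symm, h.2.1.symm⟩

/-- The edges at `v` are `d 0`, `d 1`, `d 2`, with other ends `x 0`, `x 1`, `x 2`. -/
def IsClawFamily (G : Graph α β) (v : α) (x : Fin 3 → α) (d : Fin 3 → β) : Prop :=
  ∀ i j k, Distinct i j k → G.IsClaw v (x i) (x j) (x k) (d i) (d j) (d k)

lemma IsBispanning.isClawFamily (hG : G.IsBispanning) (hdeg : G.deg v = 3)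
    (hd : Function.Injective d) (hlink : ∀ i, G.IsLink (d i) v (x i)) :
    G.IsClawFamily v x d := by
  obtain ⟨S, T, hp⟩ := hG
  have hne : ∀ i, x i ≠ v := by
    intro i hi
    have hl := hlink i
    rw [hi] at hl
    rcases hp.mem_or_mem hl.edge_mem with h | h
    · exact hp.left.not_conn h hl (Conn.refl G _ _)
    · exact hp.right.not_conn h hl (Conn.refl G _ _)
  -- Three distinct edges at a vertex of degree three exhaust its star.
  have hrange : Set.range d = {e | G.Inc e v} := by
    refine (Set.finite_range d).eq_of_subset_of_encard_le ?_ ?_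
    · rintro _ ⟨i, rfl⟩
      exact (hlink i).inc_left
    · rw [← Set.image_univ, hd.encard_image, Set.encard_univ]
      exact hdeg.le.trans (by simp)
  intro i j k hD
  refine ⟨hlink i, hlink j, hlink k, hne i, hne j, hne k, hd.ne hD.1, hd.ne hD.2.1,
    hd.ne hD.2.2, fun e he => ?_⟩
  obtain ⟨m, rfl⟩ : e ∈ Set.range d := hrange ▸ he
  rcases hD.eq_or m with rfl | rfl | rfl <;> simp

/-! ### Distribution of the edges at `v` between the two trees -/

namespace IsClawFamily

variable (hF : G.IsClawFamily v x d)
include hF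

lemma exists_of_isTreePair (hp : G.IsTreePair S T) : ∃ i j k A B, Distinct i j k ∧
    G.Avoids v A ∧ G.Avoids v B ∧
    ((S = insert (d i) (insert (d j) A) ∧ T = insert (d k) B) ∨
      (S = insert (d k) B ∧ T = insert (d i) (insert (d j) A))) := by
  set goal : Prop := ∃ i j k A B, _
  have hS := (hF 0 1 2 (by simp [Distinct])).exists_mem hp.left
  have hT := (hF 0 1 2 (by simp [Distinct])).exists_mem hp.right
  have hmem : ∀ i j k, Distinct i j k → d i ∈ E(G) :=
    fun i j k hD => (hF i j k hD).link_a.edge_mem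
  have h0 := hp.mem_or_mem (hmem 0 1 2 (by simp [Distinct]))
  have h1 := hp.mem_or_mem (hmem 1 0 2 (by simp [Distinct]))
  have h2 := hp.mem_or_mem (hmem 2 0 1 (by simp [Distinct]))
  have hdis : ∀ e, e ∈ S → e ∉ T := fun e => hp.notMem_right
  have hl : ∀ i j k, Distinct i j k → d i ∈ S → d j ∈ S → d k ∈ T → goal := by
    intro i j k hD h1 h2 h3
    obtain ⟨A, B, hA, hB, h⟩ := (hF i j k hD).exists_of_mem hp h1 h2 h3
    exact ⟨i, j, k, A, B, hD, hA, hB, Or.inl h⟩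
  have hr : ∀ i j k, Distinct i j k → d i ∈ T → d j ∈ T → d k ∈ S → goal := by
    intro i j k hD h1 h2 h3
    obtain ⟨A, B, hA, hB, h⟩ := (hF i j k hD).exists_of_mem hp.symm h1 h2 h3
    exact ⟨i, j, k, A, B, hD, hA, hB, Or.inr h.symm⟩
  rcases h0 with h0 | h0 <;> rcases h1 with h1 | h1 <;> rcases h2 with h2 | h2
  · exact absurd hT (by simp [hdis _ h0, hdis _ h1, hdis _ h2])
  · exact hl 0 1 2 (by simp [Distinct]) h0 h1 h2
  · exact hl 0 2 1 (by simp [Distinct]) h0 h2 h1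
  · exact hr 1 2 0 (by simp [Distinct]) h1 h2 h0
  · exact hl 1 2 0 (by simp [Distinct]) h1 h2 h0
  · exact hr 0 2 1 (by simp [Distinct]) h0 h2 h1
  · exact hr 0 1 2 (by simp [Distinct]) h0 h1 h2
  · exact absurd hS (by simp [hp.notMem_left h0, hp.notMem_left h1, hp.notMem_left h2])

end IsClawFamily

/-- The attachment edge is the odd one out in the division between the trees, and the cycle edge is
then fixed by the cycle. -/
lemma HasRoles.unique (hD : Distinct i j k) (hD' : Distinct i' j' k')
    (h : G.HasRoles (d i) (d j) (d k) S T) (h' : G.HasRoles (d i') (d j') (d k') S T) :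
    i = i' ∧ k = k' := by
  obtain ⟨hp, h1, h2, h3⟩ := h
  obtain ⟨-, h1', h2', h3'⟩ := h'
  have hdis : ∀ e, e ∈ S → e ∉ T := fun e => hp.notMem_right
  rcases hD.eq_or i' with rfl | rfl | rfl <;> rcases hD.eq_or j' with rfl | rfl | rfl <;>
    rcases hD.eq_or k' with rfl | rfl | rfl
  all_goals first
    | exact absurd rfl hD'.1
    | exact absurd rfl hD'.2.1
    | exact absurd rfl hD'.2.2
    | exact ⟨rfl, rfl⟩
    | exact absurd h2 h3'
    | grind

lemma not_leaf_and_extra (hd : Function.Injective d) (h : G.InClass v x d e f S T .leaf)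
    (h' : G.InClass v x d e f S T .extra) : False := by
  obtain ⟨i, j, k, hD, h, rfl, -⟩ := h
  obtain ⟨i', j', k', hD', h', he, -⟩ := h'
  obtain ⟨rfl, rfl⟩ := HasRoles.unique hD hD' h h'
  exact hD.2.1 (hd he).symm

/-- `rho` tests only whether `none ∈ S`, so symmetry needs `none` to lie in exactly one of the two
sets. -/
lemma IsClaw.rho_swap (hc : G.IsClaw v a b c ea eb ec) {S₀ T₀ : Set (Option β)}
    (h : (G.reduction v a b).IsTreePair S₀ T₀) :
    rho ea eb ec T₀ S₀ = (rho ea eb ec S₀ T₀).swap := by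
  obtain ⟨A, B, -, -, -, ⟨rfl, rfl⟩ | ⟨rfl, rfl⟩⟩ := hc.exists_of_reduction h <;>
    rw [rho_split, rho_attach, Prod.swap]

namespace IsClawFamily

variable (hF : G.IsClawFamily v x d)
include hF

/-- This allows the first tree to be taken as the one with two edges at `v`. -/
lemma inClass_symm {cl : ExchangeClass} (h : G.InClass v x d e f S T cl) :
    G.InClass v x d e f T S cl := by
  cases cl with
  | lifted =>
    obtain ⟨i, j, k, hD, S₀, T₀, h, hb, heq⟩ := h
    exact ⟨i, j, k, hD, T₀, S₀, h.symm, hb.symm, by rw [(hF i j k hD).rho_swap h.1, ← heq]; rfl⟩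
  | leaf =>
    obtain ⟨i, j, k, hD, h, he, hf⟩ := h
    exact ⟨i, j, k, hD, h.symm, he, hf⟩
  | forwarded =>
    obtain ⟨i, j, k, hD, S₀, T₀, g, e₂, h, h₂, heq⟩ := h
    have hs := (hF i j k hD).rho_swap h.1
    have hp := ((hF i j k hD).isTauArc_forward h h₂).1.1
    refine ⟨i, j, k, hD, T₀, S₀, g, e₂, h.symm, ?_, ?_⟩
    · rw [IsForwardEdge, hs, Prod.fst_swap, Prod.snd_swap, pairCut_comm]
      exact h₂
    · have hg : g ∈ E(G) := by
        have := ((hF i j k hD).isTauArc_forward h h₂).1.2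
        rcases this with hu | hu
        · exact hp.left.subset hu.1
        · exact hp.right.subset hu.1
      rw [hs, Prod.fst_swap, Prod.snd_swap, hp.exchange_swap hg]
      refine heq.imp (fun h => ⟨h.1, h.2.1, ?_⟩) (fun h => ⟨h.1, h.2.1, ?_⟩) <;>
        rw [← h.2.2] <;> rfl
  | extra =>
    obtain ⟨i, j, k, hD, h, he, hf, hi⟩ := h
    exact ⟨i, j, k, hD, h.symm, he, hf, by rw [pairCut_comm, pairCycle_comm]; exact hi⟩

/-! ### Members of the classes are unique exchanges -/

lemma isTauArc_of_lifted (h : G.InClass v x d e f S T .lifted) :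
    G.IsTauArc e f S T ∧ ¬ G.Inc e v ∧ ¬ G.Inc f v := by
  obtain ⟨i, j, k, hD, S₀, T₀, h, hb, heq⟩ := h
  have hc := hF i j k hD
  obtain ⟨A, B, hA, hB, hp, ⟨rfl, rfl⟩ | ⟨rfl, rfl⟩⟩ := hc.exists_of_reduction h.1
  · rw [rho_split, Prod.mk.injEq] at heq
    obtain ⟨rfl, rfl⟩ := heq
    exact (hc.isTauArc_lifted_iff hA hB hp).2 ⟨h, hb⟩
  · rw [rho_attach, Prod.mk.injEq] at heq
    obtain ⟨rfl, rfl⟩ := heq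
    exact ((hc.isTauArc_lifted_iff hA hB hp).2 ⟨h.symm, hb.symm⟩).imp_left IsTauArc.symm

lemma isTauArc_of_forwarded (h : G.InClass v x d e f S T .forwarded) :
    G.IsTauArc e f S T ∧ ((¬ G.Inc e v ∧ G.Inc f v) ∨ (G.Inc e v ∧ ¬ G.Inc f v)) := by
  obtain ⟨i, j, k, hD, S₀, T₀, g, e₂, h, h₂, heq⟩ := h
  have hc := hF i j k hD
  obtain ⟨ht, hg⟩ := hc.isTauArc_forward h h₂
  have he₂ : G.Inc e₂ v := by
    rcases h₂.1 with rfl | rfl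
    exacts [hc.link_a.inc_left, hc.link_b.inc_left]
  rcases heq with ⟨rfl, rfl, heq⟩ | ⟨rfl, rfl, heq⟩
  · rw [← heq] at ht
    exact ⟨ht, Or.inl ⟨hg, he₂⟩⟩
  · have := ht.reverse
    rw [← heq] at this
    exact ⟨this, Or.inr ⟨he₂, hg⟩⟩

lemma isTauArc_of_hasRoles (hD : Distinct i j k)
    (h : G.HasRoles (d i) (d j) (d k) S T) : G.IsTauArc (d k) (d i) S T := by
  have key : ∀ {S T}, G.HasRoles (d i) (d j) (d k) S T → d i ∈ S → d j ∈ S → d k ∈ T →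
      G.IsTauArc (d k) (d i) S T := by
    intro S T h h1 h2 h3
    have hc := hF i j k hD
    obtain ⟨A, B, hA, hB, rfl, rfl⟩ := hc.exists_of_mem h.1 h1 h2 h3
    exact ⟨h.1, Or.inr (hc.leaf_exchange hA hB h.1 ((hc.hasRoles_iff hA hB h.1).1 h))⟩
  rcases h.2.1 with ⟨h1, h2, h3⟩ | ⟨h1, h2, h3⟩
  · exact key h h1 h2 h3
  · exact (key h.symm h1 h2 h3).symm

lemma isTauArc_of_leaf (h : G.InClass v x d e f S T .leaf) :
    G.IsTauArc e f S T ∧ G.Inc e v ∧ G.Inc f v := by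
  obtain ⟨i, j, k, hD, h, rfl, rfl⟩ := h
  have hc := hF i j k hD
  exact ⟨hF.isTauArc_of_hasRoles hD h, hc.link_c.inc_left, hc.link_a.inc_left⟩

lemma isTauArc_of_extra (h : G.InClass v x d e f S T .extra) :
    G.IsTauArc e f S T ∧ G.Inc e v ∧ G.Inc f v := by
  obtain ⟨i, j, k, hD, h, rfl, rfl, hi⟩ := h
  have hc := hF i j k hD
  refine ⟨⟨h.1, ?_⟩, hc.link_a.inc_left, hc.link_c.inc_left⟩
  rcases h.2.1 with ⟨h1, h2, h3⟩ | ⟨h1, h2, h3⟩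
  · rw [h.1.pairCut_eq h1, h.1.pairCycle_eq h1] at hi
    exact Or.inl (h.1.isUniqueExchange_iff_inter.2 ⟨h1, h3, hi⟩)
  · rw [pairCut_comm, pairCycle_comm, h.1.symm.pairCut_eq h1, h.1.symm.pairCycle_eq h1] at hi
    exact Or.inr (h.1.symm.isUniqueExchange_iff_inter.2 ⟨h1, h3, hi⟩)

lemma inClass_unique (hd : Function.Injective d) {cl cl' : ExchangeClass}
    (h : G.InClass v x d e f S T cl) (h' : G.InClass v x d e f S T cl') : cl = cl' := by
  have h1 := hF.isTauArc_of_lifted (e := e) (f := f) (S := S) (T := T)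
  have h2 := hF.isTauArc_of_leaf (e := e) (f := f) (S := S) (T := T)
  have h3 := hF.isTauArc_of_forwarded (e := e) (f := f) (S := S) (T := T)
  have h4 := hF.isTauArc_of_extra (e := e) (f := f) (S := S) (T := T)
  have h5 := not_leaf_and_extra (G := G) (v := v) (x := x) hd (e := e) (f := f) (S := S) (T := T)
  -- Incidence of `e` and `f` with `v` tells all classes apart except leaf and extra, which differ
  -- in whether `e` is the attachment or the cycle edge.
  cases cl <;> cases cl' <;> first | rfl | (exfalso; tauto)

/-! ### Unique exchanges are members of the classes -/

section

variable (hD : Distinct i j k) (hA : G.Avoids v A) (hB : G.Avoids v B)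
  (hp : G.IsTreePair (insert (d i) (insert (d j) A)) (insert (d k) B))
include hD hA hB hp

/-- A unique exchange of an edge at `v` for an edge avoiding `v` is the reverse of a forwarded
exchange. -/
lemma forwarded_of_right (hf : f ∈ B)
    (hu : G.IsUniqueExchange (insert (d i) (insert (d j) A)) (insert (d k) B) (d j) f) :
    G.InClass v x d (d j) f (insert (d i) (insert (d j) A)) (insert (d k) B) .forwarded := by
  have hc := hF i j k hD
  have hfv := hc.ne_of_not_inc (hB f hf)
  have h1 : insert f (insert (d i) (insert (d j) A) \ {d j}) = insert (d i) (insert f A) := by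
    rw [hc.split_sdiff_right hA, Set.insert_comm]
  have h2 : insert (d j) (insert (d k) B) \ {f} = insert (d j) (insert (d k) (B \ {f})) := by
    rw [insert_sdiff_of_ne hfv.2.1, insert_sdiff_of_ne hfv.2.2]
  have hfA : f ∉ A := fun h => hp.notMem_left (Set.mem_insert_of_mem _ hf) (by simp [h])
  have hp' := hu.2.2.1.symm
  have hu' := hu.reverse hp
  rw [h1, h2] at hp' hu'
  have hA' : G.Avoids v (insert f A) := by
    rintro e (rfl | he)
    exacts [hB _ hf, hA e he]
  have hB' : G.Avoids v (B \ {f}) := hB.sdiff _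
  -- After the exchange `d i` is alone in its tree and `d j`, `d k` share the other, so the reverse
  -- exchange is forwarded from the reduction that splits `d j`, `d k`.
  have hc' := hc.rotate
  have hf₀ := hc'.forward_of_exchange hB' hA' hp' (Or.inl rfl) (hB f hf) hu'
  have hcut := (((hp'.symm.isUniqueExchange_iff).1 hu').2.2 (d j) (by simp)).2 rfl
  refine ⟨j, k, i, hD.rotate, some '' insert f A, insert none (some '' (B \ {f})), f, d j,
    ⟨((hc'.isTreePair_iff hB' hA').2 hp').symm, Or.inl hf₀⟩,
    (hp'.isForwardEdge_attach_iff (by simp)).2 ⟨Or.inl rfl, hcut.1⟩, Or.inr ⟨rfl, rfl, ?_⟩⟩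
  rw [rho_attach, exchange_of_mem (by simp), Prod.mk.injEq]
  constructor
  · rw [insert_sdiff_of_ne hfv.1, Set.insert_sdiff_self_of_notMem hfA, Set.insert_comm]
  · rw [Set.insert_comm (d j) (d k), Set.insert_comm f (d k), Set.insert_comm f (d j),
      Set.insert_sdiff_self_of_mem hf, Set.insert_comm (d k) (d j),
      Set.insert_sdiff_self_of_notMem]
    simp [hc.bc, hB.notMem hc.link_b]

lemma leaf_of_left (h : d i ∈ G.fundCycle (insert (d i) (insert (d j) A)) (d k)) :
    G.InClass v x d (d k) (d i) (insert (d i) (insert (d j) A)) (insert (d k) B) .leaf :=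
  ⟨i, j, k, hD, ((hF i j k hD).hasRoles_iff hA hB hp).2 h, rfl, rfl⟩

lemma extra_of_left
    (hu : G.IsUniqueExchange (insert (d i) (insert (d j) A)) (insert (d k) B) (d i) (d k))
    (h : d i ∈ G.fundCycle (insert (d i) (insert (d j) A)) (d k)) :
    G.InClass v x d (d i) (d k) (insert (d i) (insert (d j) A)) (insert (d k) B) .extra := by
  refine ⟨i, j, k, hD, ((hF i j k hD).hasRoles_iff hA hB hp).2 h, rfl, rfl, ?_⟩
  rw [hp.pairCut_eq (by simp), hp.pairCycle_eq (by simp)]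
  exact (hp.isUniqueExchange_iff_inter.1 hu).2.2

/-- A case distinction on which of `e`, `f` meet `v`, and on the tree containing `e`; interchanging
`d i` and `d j` covers the mirror cases. -/
lemma exists_inClass_split
    (h : G.IsTauArc e f (insert (d i) (insert (d j) A)) (insert (d k) B)) :
    ∃ cl, G.InClass v x d e f (insert (d i) (insert (d j) A)) (insert (d k) B) cl := by
  have hc := hF i j k hD
  have hcomm : insert (d i) (insert (d j) A) = insert (d j) (insert (d i) A) :=
    Set.insert_comm _ _ _
  have hp' := hp
  rw [hcomm] at hp'
  by_cases hev : G.Inc e v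
  · rcases h.2 with hu | hu
    · rcases hu.2.1 with rfl | hf
      · obtain ⟨he, hcyc⟩ := hc.mem_fundCycle_of_extra_exchange hA hB hp hu
        refine ⟨.extra, ?_⟩
        rcases he with rfl | rfl
        · exact hF.extra_of_left hD hA hB hp hu hcyc
        · rw [hcomm] at hu hcyc ⊢
          exact hF.extra_of_left hD.swap hA hB hp' hu hcyc
      · refine ⟨.forwarded, ?_⟩
        rcases hu.1 with rfl | rfl | he
        · rw [hcomm] at hu ⊢
          exact hF.forwarded_of_right hD.swap hA hB hp' hf hu
        · exact hF.forwarded_of_right hD hA hB hp hf hu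
        · exact absurd hev (hA e he)
    · rcases hu.1 with rfl | he
      · obtain ⟨hf, hcyc⟩ := hc.mem_fundCycle_of_leaf_exchange hA hB hp hu
        refine ⟨.leaf, ?_⟩
        rcases hf with rfl | rfl
        · exact hF.leaf_of_left hD hA hB hp hcyc
        · rw [hcomm] at hcyc ⊢
          exact hF.leaf_of_left hD.swap hA hB hp' hcyc
      · exact absurd hev (hB e he)
  · by_cases hfv : G.Inc f v
    · rcases h.2 with hu | hu
      · rcases hu.2.1 with rfl | hf
        · rcases (hc.mem_fundCycle_of_extra_exchange hA hB hp hu).1 with rfl | rfl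
          · exact absurd hc.link_a.inc_left hev
          · exact absurd hc.link_b.inc_left hev
        · exact absurd hfv (hB f hf)
      · have hf : f = d i ∨ f = d j := by
          rcases hu.2.1 with hf | hf | hf
          exacts [Or.inl hf, Or.inr hf, absurd hfv (hA f hf)]
        have heB : e ∈ B := hu.1.resolve_left (hc.ne_of_not_inc hev).2.2
        have hcut := (((hp.symm.isUniqueExchange_iff).1 hu).2.2 f hu.2.1).2 rfl
        exact ⟨.forwarded, i, j, k, hD, insert none (some '' A), some '' B, e, f,
          ⟨(hc.isTreePair_iff hA hB).2 hp, Or.inr (hc.forward_of_exchange hA hB hp hf hev hu)⟩,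
          (hp.isForwardEdge_split_iff heB).2 ⟨hf, hcut.1⟩, Or.inl ⟨rfl, rfl, rho_split.symm⟩⟩
    · have := (hc.isTauArc_lifted_iff hA hB hp).1 ⟨h, hev, hfv⟩
      exact ⟨.lifted, i, j, k, hD, _, _, this.1, this.2, rho_split.symm⟩

lemma exists_leaf_split : ∃ e f,
    G.InClass v x d e f (insert (d i) (insert (d j) A)) (insert (d k) B) .leaf := by
  by_cases h : d i ∈ G.fundCycle (insert (d i) (insert (d j) A)) (d k)
  · exact ⟨_, _, hF.leaf_of_left hD hA hB hp h⟩
  · have h' := ((hF i j k hD).right_mem_fundCycle_iff_left_notMem hA hB hp).2 h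
    rw [Set.insert_comm] at hp h' ⊢
    exact ⟨_, _, hF.leaf_of_left hD.swap hA hB hp h'⟩

end

lemma exists_inClass (h : G.IsTauArc e f S T) : ∃ cl, G.InClass v x d e f S T cl := by
  obtain ⟨i, j, k, A, B, hD, hA, hB, ⟨rfl, rfl⟩ | ⟨rfl, rfl⟩⟩ := hF.exists_of_isTreePair h.1
  · exact hF.exists_inClass_split hD hA hB h.1 h
  · obtain ⟨cl, hcl⟩ := hF.exists_inClass_split hD hA hB h.1.symm h.symm
    exact ⟨cl, hF.inClass_symm hcl⟩

lemma existsUnique_leaf (hp : G.IsTreePair S T) :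
    ∃! p : β × β, G.InClass v x d p.1 p.2 S T .leaf := by
  have hex : ∃ e f, G.InClass v x d e f S T .leaf := by
    obtain ⟨i, j, k, A, B, hD, hA, hB, ⟨rfl, rfl⟩ | ⟨rfl, rfl⟩⟩ := hF.exists_of_isTreePair hp
    · exact hF.exists_leaf_split hD hA hB hp
    · obtain ⟨e, f, h⟩ := hF.exists_leaf_split hD hA hB hp.symm
      exact ⟨e, f, hF.inClass_symm h⟩
  obtain ⟨e, f, h⟩ := hex
  refine ⟨(e, f), h, ?_⟩
  rintro ⟨e', f'⟩ ⟨i', j', k', hD', h', rfl, rfl⟩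
  obtain ⟨i, j, k, hD, h, rfl, rfl⟩ := h
  obtain ⟨rfl, rfl⟩ := HasRoles.unique hD hD' h h'
  rfl

end IsClawFamily

end Graph

theorem mainTheorem3 {α β : Type*} (G : Graph α β) (hG : G.IsAtomic)
    (v : α) (hv : v ∈ V(G)) (hdeg : G.deg v = 3)
    (x : Fin 3 → α) (d : Fin 3 → β) (hd : Function.Injective d)
    (hlink : ∀ i, G.IsLink (d i) v (x i)) :
    -- every unique exchange lies in exactly one of the four classes
    (∀ e f S T, G.IsTauArc e f S T → ∃! c, G.InClass v x d e f S T c) ∧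
    -- every member of the four classes is a unique exchange
    (∀ c e f S T, G.InClass v x d e f S T c → G.IsTauArc e f S T) ∧
    -- every tree pair has exactly one exchange of the leaf class
    (∀ S T, G.IsTreePair S T → ∃! p : β × β, G.InClass v x d p.1 p.2 S T .leaf) ∧
    -- every unique exchange targeting a split edge is forwarded to exactly one edge
    (∀ i j k, Graph.Distinct i j k → ∀ (S₀ T₀ : Set (Option β)) (g : β),
      (G.reduction v (x i) (x j)).IsTauArc (some g) none S₀ T₀ →
        ∃! e₂, G.IsForwardEdge (d i) (d j) (d k) g S₀ T₀ e₂) := by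
  have hF := hG.1.isClawFamily hdeg hd hlink
  refine ⟨fun e f S T h => ?_, fun c e f S T h => ?_, fun S T hp => hF.existsUnique_leaf hp,
    fun i j k hD S₀ T₀ g h => (hF i j k hD).existsUnique_isForwardEdge h⟩
  · obtain ⟨c, hc⟩ := hF.exists_inClass h
    exact ⟨c, hc, fun c' hc' => hF.inClass_unique hd hc' hc⟩
  · cases c with
    | lifted => exact (hF.isTauArc_of_lifted h).1
    | leaf => exact (hF.isTauArc_of_leaf h).1
    | forwarded => exact (hF.isTauArc_of_forwarded h).1
    | extra => exact (hF.isTauArc_of_extra h).1
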